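/- Call a machine a partial computable function \(U\) that takes a binary program \(p\) and a binary condition \(y\) and, if it halts, outputs a binary string \(U(p,y)\). It is prefix-free if for every \(y\) no program on which \(U(\cdot,y)\) halts has a proper prefix on which \(U(\cdot,y)\) halts. The complexity of \(x\) given \(y\) relative to \(U\) is \(\min\{|p| : U(p,y)=x\}\) (and \(\infty\) if there is no such \(p\)). A machine is an optimal plain machine (respectively an optimal prefix-free machine) if, for every machine \(V\) (respectively, it is prefix-free and for every prefix-free machine \(V\)), its complexity exceeds that relative to \(V\) by at most a constant that depends on \(V\) but not on \(x\) and \(y\). Fix any optimal plain machine and any optimal prefix-free machine, and let \(C(x)\) and \(K(x)\) be the complexities of \(x\) given the empty string relative to them; for a natural number \(n\), \(K(n)\) is the complexity of its binary expansion. Then there exist a constant \(c\) and infinitely many binary strings \(x\) such that \[ |x| - C(x) \le c \qquad\text{and}\qquad |x| + K(|x|) - K(x) \ge \log_2\log_2 |x| - c . \] -/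

import Mathlib

/-- A machine `U` takes a program `p` and a condition `y` (binary strings) and either diverges or
outputs a binary string `U p y`.  It is required to be partial computable where it is used. -/
abbrev Machine := List Bool → List Bool →. List Bool

/-- The complexity of `x` given `y` relative to the machine `U`: the least length of a program `p`
with `U p y = x`, and `⊤` if there is no such program. -/
noncomputable def condComplexity (U : Machine) (x y : List Bool) : ℕ∞ :=
  ⨅ (p : List Bool) (_ : x ∈ U p y), (p.length : ℕ∞)

/-- A program for `x` bounds its complexity. -/
theorem condComplexity_le {U : Machine} {p x y : List Bool} (h : x ∈ U p y) :
    condComplexity U x y ≤ (p.length : ℕ∞) :=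
  iInf₂_le (f := fun (p : List Bool) (_ : x ∈ U p y) => (p.length : ℕ∞)) p h

/-- The unconditional complexity: the condition is the empty string. -/
noncomputable def complexity (U : Machine) (x : List Bool) : ℕ∞ :=
  condComplexity U x []

/-- For each condition `y`, no program that halts has a proper prefix that halts. -/
def IsPrefixFree (U : Machine) : Prop :=
  ∀ p q y : List Bool, (U p y).Dom → (U q y).Dom → q <+: p → q = p

/-- A partial computable machine whose complexity is minimal, up to an additive constant, among
those of all partial computable machines. -/
def IsOptimalPlain (U : Machine) : Prop :=
  Partrec₂ U ∧ ∀ V : Machine, Partrec₂ V →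
    ∃ c : ℕ, ∀ x y : List Bool, condComplexity U x y ≤ condComplexity V x y + c

/-- A prefix-free partial computable machine whose complexity is minimal, up to an additive
constant, among those of all prefix-free partial computable machines. -/
def IsOptimalPrefixFree (U : Machine) : Prop :=
  (Partrec₂ U ∧ IsPrefixFree U) ∧ ∀ V : Machine, Partrec₂ V → IsPrefixFree V →
    ∃ c : ℕ, ∀ x y : List Bool, condComplexity U x y ≤ condComplexity V x y + c

/-- Relative to an optimal plain machine every string has finite complexity. -/
theorem IsOptimalPlain.complexity_ne_top {U : Machine} (hU : IsOptimalPlain U) (x : List Bool) :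
    complexity U x ≠ ⊤ := by
  obtain ⟨c, hc⟩ := hU.2 (fun p _ => Part.some p) (Computable.fst (α := List Bool)
    (β := List Bool)).partrec
  have h1 : condComplexity (fun p _ => Part.some p) x [] ≤ (x.length : ℕ∞) :=
    condComplexity_le (U := fun p _ => Part.some p) (Part.mem_some x)
  have h2 : complexity U x ≤ ((x.length + c : ℕ) : ℕ∞) := by
    push_cast
    exact (hc x []).trans (add_le_add_left h1 _)
  exact ne_top_of_le_ne_top (ENat.natCast_ne_top _) h2

/-- Relative to an optimal prefix-free machine every string has finite complexity. -/
theorem IsOptimalPrefixFree.complexity_ne_top {U : Machine} (hU : IsOptimalPrefixFree U)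
    (x : List Bool) : complexity U x ≠ ⊤ := by
  -- compare with the machine that halts only on the empty program and outputs `x`
  let V : Machine := fun p _ => ((if p = [] then Option.some x else none : Option (List Bool)))
  have hV : Partrec₂ V := by
    refine Computable.ofOption (f := fun a : List Bool × List Bool =>
      (if a.1 = [] then Option.some x else none : Option (List Bool))) (Primrec.to_comp ?_)
    exact Primrec.ite (Primrec.eq.comp Primrec.fst (Primrec.const []))
      (Primrec.const _) (Primrec.const _)
  have hdom : ∀ p y, (V p y).Dom → p = [] := by
    intro p y h
    by_contra hp
    simp [V, hp] at h
  obtain ⟨c, hc⟩ := hU.2 V hV (fun p q y hp hq _ => by rw [hdom p y hp, hdom q y hq])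
  have h1 : condComplexity V x [] ≤ ((([] : List Bool).length : ℕ) : ℕ∞) :=
    condComplexity_le (by simp [V])
  have h2 : complexity U x ≤ ((0 + c : ℕ) : ℕ∞) := by
    push_cast
    exact (hc x []).trans (add_le_add_left h1 _)
  exact ne_top_of_le_ne_top (ENat.natCast_ne_top _) h2

/-- Complexity of strings as a natural number (the complexity is finite for optimal machines, by
the two facts above). -/
noncomputable def strComplexity (U : Machine) (x : List Bool) : ℕ :=
  (complexity U x).toNat

/-- Complexity of a natural number: that of its binary expansion. -/
noncomputable def natComplexity (U : Machine) (n : ℕ) : ℕ :=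
  strComplexity U (Nat.bits n)

/-! ### Primitive recursive combinators -/

/-! Let `w` be the binary expansion of n = |x|, of length (2T+1)2^m + 1 with T a fixed constant, so
that log log n is at most l = m + T + 3. Let x consist of the K(w)-th string of length l, the block,
followed by a string z. A shortest program of `w` yields `w` and, through its own length, K(w). The
block therefore costs nothing, and K(x) ≤ K(n) + n - l + O(1) by `exists_strComplexity_comp_le`. It
remains to find `w` and z with C(x) ≥ n - O(1); this is `exists_incompressible`.

Call v revealed for `w` once it is known that K(w) ≤ v and that all extensions to length n of the
v-th block are compressible by more than T + 5 bits. Counting programs shows that fewer than 2^(m-2)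
values are revealed for each `w`. If no z worked for any `w` of the group with parameters T and m,
then K(w) itself would be revealed for all of them.

`exists_mem_group` refutes this by a game of 2^m rounds. Let k be the complexity of the group's
name. Before round i there are 2^s candidates, where s drops by 2T+1 per round. The round number and
an index cost m + s bits, so for large T every candidate has complexity at most B_i = k + m + s + T.
Wait until each candidate reveals a value at most B_i, then keep members of the larger of two
classes: those with a revealed value above B_{i+1}, and the rest. In the first case (a hit) every
survivor has spent a value from a window used by no other round, so at most a quarter of the rounds
are hits. In the second (a miss) at least half of the candidates have complexity at most B_{i+1},
which accounts for weight 2^(T-k-m). By `coding_theorem` the whole group weighs only O(2^-k), so for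
large T at most a quarter of the rounds are misses. But every round is one or the other. -/

theorem Primrec.nat_pow : Primrec₂ ((· ^ ·) : ℕ → ℕ → ℕ) :=
  Primrec₂.unpaired'.1 Nat.Primrec.pow

theorem PrimrecPred.exists_mem {α β : Type*} [Primcodable α] [Primcodable β]
    {f : α → List β} {R : α → β → Prop} (hf : Primrec f) (hR : PrimrecRel R) :
    PrimrecPred fun a => ∃ b ∈ f a, R a b :=
  (hR.swap.exists_mem_list.comp hf Primrec.id).of_eq fun _ => Iff.rfl

theorem PrimrecPred.forall_mem {α β : Type*} [Primcodable α] [Primcodable β]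
    {f : α → List β} {R : α → β → Prop} (hf : Primrec f) (hR : PrimrecRel R) :
    PrimrecPred fun a => ∀ b ∈ f a, R a b :=
  (hR.swap.forall_mem_list.comp hf Primrec.id).of_eq fun _ => Iff.rfl

theorem Primrec.list_filter {α β : Type*} [Primcodable α] [Primcodable β]
    {f : α → List β} {R : α → β → Prop} [∀ a, DecidablePred (R a)] (hf : Primrec f)
    (hR : PrimrecRel R) : Primrec fun a => (f a).filter fun b => R a b := by
  classical
  refine ((PrimrecRel.listFilter hR.swap).comp hf Primrec.id).of_eq fun a => ?_
  simp only [id, Function.swap]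

/-! ### Lists of binary strings -/

/-- All binary strings of length `n`. -/
def strs : ℕ → List (List Bool)
  | 0 => [[]]
  | n + 1 => (strs n).map (List.cons false) ++ (strs n).map (List.cons true)

@[simp] theorem mem_strs {n : ℕ} {x : List Bool} : x ∈ strs n ↔ x.length = n := by
  induction n generalizing x with
  | zero => simp [strs]
  | succ n ih =>
    cases x with
    | nil => simp [strs]
    | cons b x => cases b <;> simp [strs, ih]

theorem nodup_strs (n : ℕ) : (strs n).Nodup := by
  induction n with
  | zero => simp [strs]
  | succ n ih =>
    refine List.Nodup.append (ih.map (List.cons_injective)) (ih.map (List.cons_injective)) ?_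
    intro a h1 h2
    simp only [List.mem_map] at h1 h2
    obtain ⟨x, -, rfl⟩ := h1
    obtain ⟨y, -, h⟩ := h2
    simp at h

@[simp] theorem length_strs (n : ℕ) : (strs n).length = 2 ^ n := by
  induction n with
  | zero => simp [strs]
  | succ n ih => simp [strs, ih, pow_succ]; ring

theorem primrec_strs : Primrec strs := by
  have h : Primrec fun n : ℕ => (Nat.rec [[]]
      (fun _ l => l.map (List.cons false) ++ l.map (List.cons true)) n : List (List Bool)) := by
    refine Primrec.nat_rec₁ [[]] (f := fun _ l => l.map (List.cons false) ++ l.map (List.cons true))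
      ?_
    refine Primrec.list_append.comp (Primrec.list_map Primrec.snd ?_)
      (Primrec.list_map Primrec.snd ?_)
    · exact Primrec.list_cons.comp (Primrec.const false) Primrec.snd
    · exact Primrec.list_cons.comp (Primrec.const true) Primrec.snd
  refine h.of_eq fun n => ?_
  induction n with
  | zero => rfl
  | succ n ih => simp only [strs, ← ih]

/-- All binary strings of length at most `n`. -/
def strsLe (n : ℕ) : List (List Bool) := (List.range (n + 1)).flatMap strs

@[simp] theorem mem_strsLe {n : ℕ} {x : List Bool} : x ∈ strsLe n ↔ x.length ≤ n := by
  simp [strsLe]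

theorem nodup_strsLe (n : ℕ) : (strsLe n).Nodup := by
  refine List.nodup_flatMap.2 ⟨fun k _ => nodup_strs k, ?_⟩
  refine (List.nodup_range (n := n + 1)).imp ?_
  intro a b hab x h1 h2
  simp at h1 h2
  omega

theorem primrec_strsLe : Primrec strsLe :=
  Primrec.list_flatMap (Primrec.list_range.comp Primrec.succ) (primrec_strs.comp Primrec.snd)

/-- The big-endian value of a binary string. -/
def beVal (x : List Bool) : ℕ := x.foldl (fun a b => 2 * a + b.toNat) 0

theorem primrec_beVal : Primrec beVal := by
  refine Primrec.list_foldl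
    (h := fun (_ : List Bool) (p : ℕ × Bool) => 2 * p.1 + p.2.toNat) Primrec.id (Primrec.const 0) ?_
  refine Primrec.nat_add.comp (Primrec.nat_mul.comp (Primrec.const 2)
    (Primrec.fst.comp Primrec.snd)) ?_
  exact (Primrec.dom_bool Bool.toNat).comp (Primrec.snd.comp Primrec.snd)

theorem beVal_append_singleton (x : List Bool) (b : Bool) :
    beVal (x ++ [b]) = 2 * beVal x + b.toNat := by
  simp [beVal]

/-- Extensions of a string stay in its dyadic interval; this turns prefix comparison into
disjointness of intervals. -/
theorem beVal_append (x y : List Bool) :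
    ∃ t < 2 ^ y.length, beVal (x ++ y) = beVal x * 2 ^ y.length + t := by
  induction y using List.reverseRecOn with
  | nil => exact ⟨0, by simp⟩
  | append_singleton y b ih =>
    obtain ⟨t, ht, h⟩ := ih
    refine ⟨2 * t + b.toNat, ?_, ?_⟩
    · rw [List.length_append, List.length_singleton, pow_succ]
      have := Bool.toNat_le b
      omega
    · rw [← List.append_assoc, beVal_append_singleton, h, List.length_append, List.length_singleton,
        pow_succ]
      ring

theorem exists_beVal (n : ℕ) : ∀ v < 2 ^ n, ∃ x : List Bool, x.length = n ∧ beVal x = v := by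
  induction n with
  | zero => intro v hv; exact ⟨[], rfl, by simp [beVal] at *; omega⟩
  | succ n ih =>
    intro v hv
    obtain ⟨x, hx, hxv⟩ := ih (v / 2) (by rw [pow_succ] at hv; omega)
    refine ⟨x ++ [decide (v % 2 = 1)], by simp [hx], ?_⟩
    rw [beVal_append_singleton, hxv]
    rcases Nat.mod_two_eq_zero_or_one v with h | h <;> simp [h] <;> omega

/-! ### Binary expansions -/

/-- The little-endian value of a binary string. -/
def leVal (x : List Bool) : ℕ := x.foldr (fun b a => 2 * a + b.toNat) 0

theorem primrec_leVal : Primrec leVal := by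
  refine Primrec.list_foldr
    (h := fun (_ : List Bool) (p : Bool × ℕ) => 2 * p.2 + p.1.toNat) Primrec.id (Primrec.const 0) ?_
  refine Primrec.nat_add.comp (Primrec.nat_mul.comp (Primrec.const 2)
    (Primrec.snd.comp Primrec.snd)) ?_
  exact (Primrec.dom_bool Bool.toNat).comp (Primrec.fst.comp Primrec.snd)

theorem leVal_append_true_bounds (y : List Bool) :
    2 ^ y.length ≤ leVal (y ++ [true]) ∧ leVal (y ++ [true]) < 2 ^ (y.length + 1) := by
  induction y with
  | nil => simp [leVal]
  | cons b y ih =>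
    have h : leVal (b :: y ++ [true]) = 2 * leVal (y ++ [true]) + b.toNat := by simp [leVal]
    have := Bool.toNat_le b
    rw [h, List.length_cons, pow_succ, pow_succ 2 (y.length + 1)]
    omega

/-- The final `true` is the leading digit, so nothing is lost to leading zeros; this is why group
members end with a one. -/
theorem bits_leVal (y : List Bool) : Nat.bits (leVal (y ++ [true])) = y ++ [true] := by
  induction y with
  | nil => simp [leVal]
  | cons b y ih =>
    have h : leVal (b :: y ++ [true]) = Nat.bit b (leVal (y ++ [true])) := by
      cases b <;> simp [leVal, Nat.bit]
    rw [h, Nat.bits_append_bit, ih]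
    · rfl
    · intro h0
      have := (leVal_append_true_bounds y).1
      have := Nat.one_le_two_pow (n := y.length)
      omega

/-! ### Staged evaluation -/

theorem Partrec.exists_stages {f : List Bool →. List Bool} (hf : Partrec f) :
    ∃ S : ℕ → List Bool → Option (List Bool), Primrec₂ S ∧
      (∀ s t x y, s ≤ t → S s x = some y → S t x = some y) ∧
      ∀ x y, y ∈ f x ↔ ∃ s, S s x = some y := by
  obtain ⟨c, hc⟩ := Nat.Partrec.Code.exists_code.1 hf
  refine ⟨fun s x => (Nat.Partrec.Code.evaln s c (Encodable.encode x)).bind Encodable.decode,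
    ?_, ?_, ?_⟩
  · refine Primrec.option_bind ?_ (Primrec.decode.comp Primrec.snd)
    exact Nat.Partrec.Code.primrec_evaln.comp (Primrec.pair (Primrec.pair Primrec.fst
      (Primrec.const c)) (Primrec.encode.comp Primrec.snd))
  · intro s t x y hst h
    simp only [Option.bind_eq_some_iff] at h ⊢
    obtain ⟨a, ha, hy⟩ := h
    exact ⟨a, Nat.Partrec.Code.evaln_mono hst ha, hy⟩
  · intro x y
    have key : ∀ a, a ∈ c.eval (Encodable.encode x) ↔ ∃ y ∈ f x, Encodable.encode y = a := by
      intro a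
      rw [hc]
      simp
    constructor
    · intro h
      obtain ⟨s, hs⟩ := Nat.Partrec.Code.evaln_complete.1 ((key (Encodable.encode y)).2 ⟨y, h, rfl⟩)
      exact ⟨s, by simp [Option.mem_def.1 hs]⟩
    · rintro ⟨s, hs⟩
      simp only [Option.bind_eq_some_iff] at hs
      obtain ⟨a, ha, hy⟩ := hs
      obtain ⟨y', hy', rfl⟩ := (key a).1 (Nat.Partrec.Code.evaln_sound ha)
      simp at hy
      exact hy ▸ hy'

/-! ### Complexity as a natural number -/

theorem exists_program {U : Machine} {x : List Bool} (h : complexity U x ≠ ⊤) :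
    ∃ p, p.length = strComplexity U x ∧ x ∈ U p [] := by
  by_contra hc
  push Not at hc
  have h1 : ((strComplexity U x + 1 : ℕ) : ℕ∞) ≤ complexity U x := by
    refine le_iInf₂ fun p hp => ?_
    have h2 : complexity U x ≤ p.length := condComplexity_le hp
    have h3 : strComplexity U x ≤ p.length := ENat.toNat_le_of_le_natCast h2
    have h4 : p.length ≠ strComplexity U x := fun h => hc p h hp
    exact_mod_cast (by omega : strComplexity U x + 1 ≤ p.length)
  have h5 : ((strComplexity U x : ℕ) : ℕ∞) = complexity U x := ENat.natCast_toNat h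
  rw [← h5] at h1
  have := ENat.natCast_le_natCast.1 h1
  omega

theorem strComplexity_le {U : Machine} {p x : List Bool} (h : x ∈ U p []) :
    strComplexity U x ≤ p.length :=
  ENat.toNat_le_of_le_natCast (condComplexity_le h)

theorem IsOptimalPrefixFree.exists_strComplexity_le {V W : Machine} (hV : IsOptimalPrefixFree V)
    (hW : Partrec₂ W) (hW' : IsPrefixFree W) :
    ∃ d, ∀ p x, x ∈ W p [] → strComplexity V x ≤ p.length + d := by
  obtain ⟨d, hd⟩ := hV.2 W hW hW'
  refine ⟨d, fun p x h => ENat.toNat_le_of_le_natCast ?_⟩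
  push_cast
  exact (hd x []).trans (add_le_add_left (condComplexity_le h) _)

/-! ### The Kraft–Chaitin theorem -/

/-- The weight of a request. -/
noncomputable def reqWeight (o : Option (ℕ × List Bool)) : ℝ :=
  o.elim 0 fun a => (1 / 2) ^ a.1

@[simp] theorem reqWeight_some (a : ℕ × List Bool) : reqWeight (some a) = (1 / 2) ^ a.1 := rfl

theorem reqWeight_nonneg (o : Option (ℕ × List Bool)) : 0 ≤ reqWeight o := by
  cases o <;> simp [reqWeight]

/-- The total weight of the first `i` requests, scaled by `2 ^ i`. -/
def reqNum (req : ℕ → Option (ℕ × List Bool)) : ℕ → ℕ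
  | 0 => 0
  | i + 1 => 2 * reqNum req i + (req i).elim 0 fun a => 2 ^ (i + 1 - a.1)

theorem primrec_reqNum {req : ℕ → Option (ℕ × List Bool)} (hreq : Primrec req) :
    Primrec (reqNum req) := by
  have h : Primrec fun n : ℕ => (Nat.rec 0
      (fun i l => 2 * l + (req i).elim 0 fun a => 2 ^ (i + 1 - a.1)) n : ℕ) := by
    refine Primrec.nat_rec₁ 0
      (f := fun i l => 2 * l + (req i).elim 0 fun a => 2 ^ (i + 1 - a.1)) ?_
    refine Primrec.nat_add.comp (Primrec.nat_mul.comp (Primrec.const 2) Primrec.snd) ?_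
    have h2 : Primrec fun p : ℕ × ℕ => (Option.casesOn (req p.1) 0
        (fun a => 2 ^ (p.1 + 1 - a.1)) : ℕ) := by
      refine Primrec.option_casesOn (hreq.comp Primrec.fst) (Primrec.const 0) ?_
      refine Primrec.nat_pow.comp (Primrec.const 2) (Primrec.nat_sub.comp
        (Primrec.succ.comp (Primrec.fst.comp Primrec.fst)) (Primrec.fst.comp Primrec.snd))
    refine h2.of_eq fun p => ?_
    cases req p.1 <;> rfl
  refine h.of_eq fun n => ?_
  induction n with
  | zero => rfl
  | succ n ih => simp only [reqNum, ← ih]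

/-- The truncated subtraction in `reqNum` is exact because a request at index i has length at most
i. -/
theorem reqNum_eq {req : ℕ → Option (ℕ × List Bool)}
    (hle : ∀ i r w, req i = some (r, w) → r ≤ i) (n : ℕ) :
    (reqNum req n : ℝ) = 2 ^ n * ∑ i ∈ Finset.range n, reqWeight (req i) := by
  induction n with
  | zero => simp [reqNum]
  | succ n ih =>
    rw [reqNum, Finset.sum_range_succ, mul_add, pow_succ]
    push_cast
    rw [ih]
    cases h : req n with
    | none => simp [reqWeight]; ring
    | some a =>
      have h1 : a.1 ≤ n := hle n a.1 a.2 h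
      simp only [Option.elim, reqWeight]
      obtain ⟨k, hk⟩ := Nat.exists_eq_add_of_le h1
      rw [show n + 1 - a.1 = k + 1 by omega, hk]
      push_cast
      rw [pow_succ, pow_add]
      have : (2 : ℝ) ^ a.1 * (1 / 2) ^ a.1 = 1 := by rw [← mul_pow]; norm_num
      linear_combination (-2 * (2 : ℝ) ^ k) * this

/-- The value of the code word for a request of length `r` at stage `i`. -/
def reqCode (req : ℕ → Option (ℕ × List Bool)) (i r : ℕ) : ℕ :=
  (reqNum req i * 2 ^ (r + 1) + (2 ^ i - 1)) / 2 ^ i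

/-- Adding 2^i - 1 before the division rounds up: `reqCode` is the ceiling of the partial sum times
2^(r+1). -/
theorem reqCode_bounds {req : ℕ → Option (ℕ × List Bool)}
    (hle : ∀ i r w, req i = some (r, w) → r ≤ i) (i r : ℕ) :
    (∑ k ∈ Finset.range i, reqWeight (req k)) * 2 ^ (r + 1) ≤ reqCode req i r ∧
    (reqCode req i r : ℝ) < (∑ k ∈ Finset.range i, reqWeight (req k)) * 2 ^ (r + 1) + 1 := by
  set a := ∑ k ∈ Finset.range i, reqWeight (req k) with ha
  have h0 : 0 < 2 ^ i := by positivity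
  have hn := reqNum_eq hle i
  rw [← ha] at hn
  have hdiv := Nat.div_add_mod (reqNum req i * 2 ^ (r + 1) + (2 ^ i - 1)) (2 ^ i)
  have hmod := Nat.mod_lt (reqNum req i * 2 ^ (r + 1) + (2 ^ i - 1)) h0
  change 2 ^ i * reqCode req i r + _ = _ at hdiv
  have h1 : reqNum req i * 2 ^ (r + 1) ≤ 2 ^ i * reqCode req i r := by omega
  have h2 : 2 ^ i * reqCode req i r < reqNum req i * 2 ^ (r + 1) + 2 ^ i := by omega
  have h1' : (reqNum req i : ℝ) * 2 ^ (r + 1) ≤ 2 ^ i * reqCode req i r := by exact_mod_cast h1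
  have h2' : (2 : ℝ) ^ i * reqCode req i r < reqNum req i * 2 ^ (r + 1) + 2 ^ i := by
    exact_mod_cast h2
  rw [hn] at h1' h2'
  have hp : (0 : ℝ) < 2 ^ i := by positivity
  constructor
  · refine le_of_mul_le_mul_left ?_ hp
    linarith
  · refine lt_of_mul_lt_mul_left ?_ hp.le
    linarith

/-- A request of length r owns the interval of length 2^-r that starts at the sum of the earlier
weights. It need not be dyadic but contains a dyadic interval of half its length, hence code words
of length r + 1, with requests in any order. Disjoint intervals make the code prefix-free. -/
theorem exists_prefixFree_of_requests {req : ℕ → Option (ℕ × List Bool)} (hreq : Primrec req)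
    (hle : ∀ i r w, req i = some (r, w) → r ≤ i)
    (kraft : ∀ n, ∑ i ∈ Finset.range n, reqWeight (req i) ≤ 1) :
    ∃ W : Machine, Partrec₂ W ∧ IsPrefixFree W ∧
      ∀ i r w, req i = some (r, w) → ∃ p, p.length = r + 1 ∧ w ∈ W p [] := by
  let step : List Bool → ℕ → Option (List Bool) := fun p i => (req i).bind fun a =>
    if p.length = a.1 + 1 ∧ beVal p = reqCode req i a.1 then some a.2 else none
  have hstep : ∀ p i w, step p i = some w ↔
      ∃ r, req i = some (r, w) ∧ p.length = r + 1 ∧ beVal p = reqCode req i r := by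
    intro p i w
    simp only [step, Option.bind_eq_some_iff, Option.ite_none_right_eq_some, Prod.exists]
    constructor
    · rintro ⟨r, w', h1, h2, h3⟩
      simp only [Option.some.injEq] at h3
      subst h3
      exact ⟨r, h1, h2⟩
    · rintro ⟨r, h1, h2⟩
      exact ⟨r, w, h1, h2, rfl⟩
  have hprim : Primrec₂ step := by
    refine Primrec.option_bind (hreq.comp Primrec.snd) ?_
    refine Primrec.ite (PrimrecPred.and ?_ ?_) (Primrec.option_some.comp
      (Primrec.snd.comp Primrec.snd)) (Primrec.const none)
    · exact Primrec.eq.comp (Primrec.list_length.comp (Primrec.fst.comp Primrec.fst))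
        (Primrec.succ.comp (Primrec.fst.comp Primrec.snd))
    · refine Primrec.eq.comp (primrec_beVal.comp (Primrec.fst.comp Primrec.fst)) ?_
      have hi : Primrec fun x : (List Bool × ℕ) × ℕ × List Bool => 2 ^ x.1.2 :=
        Primrec.nat_pow.comp (Primrec.const 2) (Primrec.snd.comp Primrec.fst)
      refine Primrec.nat_div.comp (Primrec.nat_add.comp (Primrec.nat_mul.comp
        ((primrec_reqNum hreq).comp (Primrec.snd.comp Primrec.fst)) (Primrec.nat_pow.comp
          (Primrec.const 2) (Primrec.succ.comp (Primrec.fst.comp Primrec.snd))))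
          (Primrec.nat_sub.comp hi (Primrec.const 1))) hi
  have hmono : Monotone fun n => ∑ i ∈ Finset.range n, reqWeight (req i) := by
    refine monotone_nat_of_le_succ fun n => ?_
    rw [Finset.sum_range_succ]
    linarith [reqWeight_nonneg (req n)]
  -- a code word and its extensions determine the stage of the request
  have hint : ∀ p q i r w, req i = some (r, w) → p.length = r + 1 → beVal p = reqCode req i r →
      p <+: q → (∑ k ∈ Finset.range i, reqWeight (req k)) * 2 ^ q.length ≤ beVal q ∧
      (beVal q : ℝ) < (∑ k ∈ Finset.range (i + 1), reqWeight (req k)) * 2 ^ q.length := by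
    rintro p q i r w hi hp hv ⟨y, rfl⟩
    obtain ⟨t, ht, h⟩ := beVal_append p y
    obtain ⟨b1, b2⟩ := reqCode_bounds hle i r
    rw [Finset.sum_range_succ, hi, h, List.length_append, hp, pow_add, hv]
    simp only [reqWeight_some]
    have hy : (0 : ℝ) < 2 ^ y.length := by positivity
    have ht' : (t : ℝ) + 1 ≤ 2 ^ y.length := by exact_mod_cast ht
    have ht0 : (0 : ℝ) ≤ t := by positivity
    have hr : ((1 / 2 : ℝ)) ^ r * 2 ^ (r + 1) = 2 := by
      rw [pow_succ, ← mul_assoc, ← mul_pow]; norm_num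
    push_cast
    constructor
    · rw [← mul_assoc]
      have := mul_le_mul_of_nonneg_right b1 hy.le
      linarith
    · rw [← mul_assoc, add_mul, hr]
      have := mul_lt_mul_of_pos_right b2 hy
      nlinarith
  refine ⟨fun p _ => Nat.rfindOpt (step p), ?_, ?_, ?_⟩
  · have h1 : Partrec fun p => Nat.rfindOpt (step p) := Partrec.rfindOpt hprim.to_comp
    exact h1.comp Computable.fst
  · intro p q y hp hq hpq
    obtain ⟨i, w, hi⟩ := Nat.rfindOpt_dom.1 hp
    obtain ⟨j, w', hj⟩ := Nat.rfindOpt_dom.1 hq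
    obtain ⟨r, hi1, hi2, hi3⟩ := (hstep p i w).1 hi
    obtain ⟨r', hj1, hj2, hj3⟩ := (hstep q j w').1 hj
    obtain ⟨a1, a2⟩ := hint q p j r' w' hj1 hj2 hj3 hpq
    obtain ⟨b1, b2⟩ := hint p p i r w hi1 hi2 hi3 (List.prefix_refl p)
    have hqpos : (0 : ℝ) < 2 ^ p.length := by positivity
    have hij : i = j := by
      have e1 := lt_of_mul_lt_mul_right (a1.trans_lt b2) hqpos.le
      have e2 := lt_of_mul_lt_mul_right (b1.trans_lt a2) hqpos.le
      have f1 := hmono.reflect_lt e1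
      have f2 := hmono.reflect_lt e2
      omega
    subst hij
    rw [hi1] at hj1
    obtain ⟨rfl, rfl⟩ : r = r' ∧ w = w' := by simpa using hj1
    exact hpq.eq_of_length (by omega)
  · intro i r w hi
    obtain ⟨b1, b2⟩ := reqCode_bounds hle i r
    have hk := kraft (i + 1)
    rw [Finset.sum_range_succ, hi] at hk
    simp only [reqWeight_some] at hk
    have hr : ((1 / 2 : ℝ)) ^ r * 2 ^ (r + 1) = 2 := by
      rw [pow_succ, ← mul_assoc, ← mul_pow]; norm_num
    have hlt : (reqCode req i r : ℝ) < 2 ^ (r + 1) := by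
      have hp : (0 : ℝ) < 2 ^ (r + 1) := by positivity
      have := mul_le_mul_of_nonneg_right hk hp.le
      rw [add_mul, hr] at this
      linarith
    obtain ⟨p, hp, hv⟩ := exists_beVal (r + 1) (reqCode req i r) (by exact_mod_cast hlt)
    refine ⟨p, hp, ?_⟩
    have hs : step p i = some w := (hstep p i w).2 ⟨r, hi, hp, hv⟩
    -- The search might stop at another index; disjointness of the intervals excludes this.
    obtain ⟨w', hw'⟩ := Part.dom_iff_mem.1 (Nat.rfindOpt_dom.2 ⟨i, w, hs⟩)
    obtain ⟨j, hj⟩ := Nat.rfindOpt_spec hw'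
    obtain ⟨r', hj1, hj2, hj3⟩ := (hstep p j w').1 hj
    obtain ⟨a1, a2⟩ := hint p p i r w hi hp hv (List.prefix_refl p)
    obtain ⟨c1, c2⟩ := hint p p j r' w' hj1 hj2 hj3 (List.prefix_refl p)
    have hqpos : (0 : ℝ) < 2 ^ p.length := by positivity
    have hij : i = j := by
      have e1 := lt_of_mul_lt_mul_right (a1.trans_lt c2) hqpos.le
      have e2 := lt_of_mul_lt_mul_right (c1.trans_lt a2) hqpos.le
      have f1 := hmono.reflect_lt e1
      have f2 := hmono.reflect_lt e2
      omega
    subst hij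
    rw [hi] at hj1
    obtain ⟨rfl, rfl⟩ : r = r' ∧ w = w' := by simpa using hj1
    exact hw'

/-- A prefix-free machine serves every recursively enumerable set of requests whose weights satisfy
Kraft's inequality. -/
theorem IsOptimalPrefixFree.exists_strComplexity_le_of_kraft {V : Machine}
    (hV : IsOptimalPrefixFree V) {P : ℕ → ℕ → List Bool → Prop}
    (hP : PrimrecPred fun a : ℕ × ℕ × List Bool => P a.1 a.2.1 a.2.2)
    (mono : ∀ s r w, P s r w → P (s + 1) r w)
    (kraft : ∀ F : Finset (ℕ × List Bool), (∀ x ∈ F, ∃ s, P s x.1 x.2) →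
      ∑ x ∈ F, (1 / 2 : ℝ) ^ x.1 ≤ 1) :
    ∃ d, ∀ s r w, P s r w → strComplexity V w ≤ r + d := by
  classical
  -- A pair (r, w) is requested only at the first stage at which `P` holds, so it is paid for once.
  let new : ℕ × ℕ × List Bool → Prop := fun a =>
    P a.1 a.2.1 a.2.2 ∧ (a.1 = 0 ∨ ¬ P (a.1 - 1) a.2.1 a.2.2)
  have hnew : PrimrecPred new := by
    refine hP.and (PrimrecPred.or (Primrec.eq.comp Primrec.fst (Primrec.const 0)) ?_)
    refine PrimrecPred.not (hP.comp (Primrec.pair ?_ Primrec.snd))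
    exact Primrec.nat_sub.comp Primrec.fst (Primrec.const 1)
  have hmono : ∀ s t r w, s ≤ t → P s r w → P t r w := by
    intro s t r w hst h
    induction t, hst using Nat.le_induction with
    | base => exact h
    | succ t _ ih => exact mono _ _ _ ih
  have huniq : ∀ s t r w, new (s, r, w) → new (t, r, w) → s = t := by
    have key : ∀ s t r w, new (s, r, w) → new (t, r, w) → ¬ s < t := by
      rintro s t r w ⟨h1, -⟩ ⟨-, h2⟩ hst
      rcases h2 with h2 | h2
      · simp only at h2; omega
      · exact h2 (hmono s (t - 1) r w (by omega) h1)
    intro s t r w h1 h2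
    have a := key s t r w h1 h2
    have b := key t s r w h2 h1
    omega
  -- `decode₂` accepts only i that is the code of its value (s, r, w); this gives r ≤ i and one
  -- index per triple.
  let req : ℕ → Option (ℕ × List Bool) := fun i =>
    (Encodable.decode₂ (ℕ × ℕ × List Bool) i).bind fun a =>
      if new a then some a.2 else none
  have hreqspec : ∀ i x, req i = some x ↔ ∃ s, Encodable.decode₂ _ i = some (s, x) ∧ new (s, x) := by
    intro i x
    simp only [req, Option.bind_eq_some_iff, Option.ite_none_right_eq_some]
    constructor
    · rintro ⟨⟨s, x'⟩, h1, h2, h3⟩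
      simp only [Option.some.injEq] at h3
      subst h3
      exact ⟨s, h1, h2⟩
    · rintro ⟨s, h1, h2⟩
      exact ⟨(s, x), h1, h2, rfl⟩
  have hreq : Primrec req := by
    refine Primrec.option_bind Primrec.decode₂ (Primrec.ite (hnew.comp Primrec.snd) ?_
      (Primrec.const none))
    exact Primrec.option_some.comp (Primrec.snd.comp Primrec.snd)
  have hdec : ∀ i (a : ℕ × ℕ × List Bool), Encodable.decode₂ _ i = some a → Encodable.encode a = i :=
    fun i a h => Encodable.mem_decode₂.1 h
  have hle : ∀ i r w, req i = some (r, w) → r ≤ i := by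
    intro i r w h
    obtain ⟨s, h1, -⟩ := (hreqspec i (r, w)).1 h
    rw [← hdec i _ h1]
    simp only [Encodable.encode_prod_val]
    exact (Nat.left_le_pair _ _).trans (Nat.right_le_pair _ _)
  obtain ⟨W, hW1, hW2, hW3⟩ := exists_prefixFree_of_requests hreq hle (fun n => by
    have hinj : ∀ i j x, req i = some x → req j = some x → i = j := by
      rintro i j ⟨r, w⟩ hi hj
      obtain ⟨s, h1, h2⟩ := (hreqspec i _).1 hi
      obtain ⟨t, h3, h4⟩ := (hreqspec j _).1 hj
      rw [huniq s t r w h2 h4] at h1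
      rw [← hdec i _ h1, ← hdec j _ h3]
    let I := (Finset.range n).filter fun i => (req i).isSome
    have h1 : ∑ i ∈ Finset.range n, reqWeight (req i) = ∑ i ∈ I, reqWeight (req i) := by
      refine (Finset.sum_subset (Finset.filter_subset _ _) ?_).symm
      intro i hi1 hi2
      have : req i = none := by
        by_contra h
        exact hi2 (Finset.mem_filter.2 ⟨hi1, by rwa [Option.isSome_iff_ne_none]⟩)
      simp [this, reqWeight]
    let g : ℕ → ℕ × List Bool := fun i => (req i).getD (0, [])
    have hg : ∀ i ∈ I, req i = some (g i) := by
      intro i hi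
      obtain ⟨x, hx⟩ := Option.isSome_iff_exists.1 (Finset.mem_filter.1 hi).2
      simp [g, hx]
    have h2 : ∑ i ∈ I, reqWeight (req i) = ∑ x ∈ I.image g, (1 / 2 : ℝ) ^ x.1 := by
      rw [Finset.sum_image]
      · refine Finset.sum_congr rfl fun i hi => ?_
        rw [hg i hi]; rfl
      · intro i hi j hj hij
        refine hinj i j (g i) (hg i hi) ?_
        rw [hij]; exact hg j hj
    rw [h1, h2]
    refine kraft _ fun x hx => ?_
    obtain ⟨i, hi, rfl⟩ := Finset.mem_image.1 hx
    obtain ⟨s, -, h⟩ := (hreqspec i _).1 (hg i hi)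
    exact ⟨s, h.1⟩)
  obtain ⟨d, hd⟩ := hV.exists_strComplexity_le hW1 hW2
  refine ⟨d + 1, fun s r w h => ?_⟩
  have hex : ∃ s, P s r w := ⟨s, h⟩
  have hn : new (Nat.find hex, r, w) := by
    refine ⟨Nat.find_spec hex, ?_⟩
    by_cases h0 : Nat.find hex = 0
    · exact Or.inl h0
    · exact Or.inr (Nat.find_min hex (by simp only; omega))
  obtain ⟨p, hp, hpw⟩ := hW3 _ r w ((hreqspec (Encodable.encode (Nat.find hex, r, w)) _).2
    ⟨_, Encodable.encodek₂ _, hn⟩)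
  have := hd p w hpw
  omega

/-! ### Kraft's inequality and the coding theorem -/

theorem List.prefix_of_append_eq_append {α : Type*} {a b c d : List α} (h : a ++ b = c ++ d) :
    a <+: c ∨ c <+: a :=
  List.prefix_or_prefix_of_prefix (List.prefix_append a b) (h ▸ List.prefix_append c d)

/-- Without the empty word a prefix-free set is uniquely decodable, and Kraft–McMillan applies; with
it the set is a singleton. -/
theorem sum_half_pow_length_le_one {F : Finset (List Bool)}
    (h : ∀ p ∈ F, ∀ q ∈ F, q <+: p → q = p) : ∑ p ∈ F, (1 / 2 : ℝ) ^ p.length ≤ 1 := by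
  by_cases hnil : [] ∈ F
  · have : F = {[]} := by
      ext p
      simp only [Finset.mem_singleton]
      exact ⟨fun hp => (h p hp [] hnil List.nil_prefix).symm, fun hp => hp ▸ hnil⟩
    simp [this]
  · have hud : InformationTheory.UniquelyDecodable (F : Set (List Bool)) := by
      intro L₁
      induction L₁ with
      | nil =>
        intro L₂ _ h2 he
        cases L₂ with
        | nil => rfl
        | cons q L₂ =>
          simp only [List.flatten_nil, List.flatten_cons, List.nil_eq, List.append_eq_nil_iff] at he
          exact absurd (he.1 ▸ h2 q (by simp)) hnil
      | cons p L₁ ih =>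
        intro L₂ h1 h2 he
        cases L₂ with
        | nil =>
          simp only [List.flatten_nil, List.flatten_cons, List.append_eq_nil_iff] at he
          exact absurd (he.1 ▸ h1 p (by simp)) hnil
        | cons q L₂ =>
          have hp : p ∈ F := h1 p (by simp)
          have hq : q ∈ F := h2 q (by simp)
          simp only [List.flatten_cons] at he
          have hpq : p = q := by
            rcases List.prefix_of_append_eq_append he with h' | h'
            · exact h q hq p hp h'
            · exact (h p hp q hq h').symm
          subst hpq
          rw [ih L₂ (fun x hx => h1 x (by simp [hx])) (fun x hx => h2 x (by simp [hx]))
            (List.append_cancel_left he)]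
    simpa using InformationTheory.kraft_mcmillan_inequality hud

theorem IsPrefixFree.sum_le_one {V : Machine} (hV : IsPrefixFree V) {F : Finset (List Bool)}
    (h : ∀ p ∈ F, (V p []).Dom) : ∑ p ∈ F, (1 / 2 : ℝ) ^ p.length ≤ 1 :=
  sum_half_pow_length_le_one fun p hp q hq hpq => hV p q [] (h p hp) (h q hq) hpq

/-- The exponents are distinct, so the sum is at most a geometric series that starts at its largest
term. -/
theorem sum_half_pow_le {R : Finset ℕ} {a : ℝ} (ha : 0 ≤ a) (h : ∀ r ∈ R, (1 / 2 : ℝ) ^ r ≤ a) :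
    ∑ r ∈ R, (1 / 2 : ℝ) ^ r ≤ 2 * a := by
  rcases R.eq_empty_or_nonempty with rfl | hne
  · simpa using ha
  · set m := R.min' hne
    have hsub : R ⊆ Finset.Ico m (R.max' hne + 1) := fun r hr =>
      Finset.mem_Ico.2 ⟨R.min'_le r hr, Nat.lt_succ_of_le (R.le_max' r hr)⟩
    have key : ∀ n, m ≤ n → ∑ r ∈ Finset.Ico m n, (1 / 2 : ℝ) ^ r = 2 * (1 / 2) ^ m
        - 2 * (1 / 2) ^ n := by
      intro n hn
      induction n, hn using Nat.le_induction with
      | base => simp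
      | succ n hn ih => rw [Finset.sum_Ico_succ_top hn, ih, pow_succ]; ring
    have hm : m ≤ R.max' hne + 1 := (R.min'_le _ (R.max'_mem hne)).trans (Nat.le_succ _)
    calc ∑ r ∈ R, (1 / 2 : ℝ) ^ r
        ≤ ∑ r ∈ Finset.Ico m (R.max' hne + 1), (1 / 2 : ℝ) ^ r :=
          Finset.sum_le_sum_of_subset_of_nonneg hsub fun _ _ _ => by positivity
      _ ≤ 2 * (1 / 2) ^ m := by
          rw [key _ hm]
          have : (0 : ℝ) ≤ 2 * (1 / 2) ^ (R.max' hne + 1) := by positivity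
          linarith
      _ ≤ 2 * a := by linarith [h m (R.min'_mem hne)]

theorem Primrec.list_sum_map {α β : Type*} [Primcodable α] [Primcodable β] {f : α → List β}
    {g : α → β → ℕ} (hf : Primrec f) (hg : Primrec₂ g) :
    Primrec fun a => ((f a).map (g a)).sum :=
  Primrec.list_foldr (h := fun (_ : α) (p : ℕ × ℕ) => p.1 + p.2) (Primrec.list_map hf hg)
    (Primrec.const 0) (Primrec.nat_add.comp (Primrec.fst.comp Primrec.snd)
      (Primrec.snd.comp Primrec.snd))

/-- The mass of t, the weight of the programs whose output is related to t, is approximable from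
below, and by `huniq` different t use disjoint programs. Requesting t at length r once the mass
found reaches 2 * 2^-r spends at most the mass of t on it, hence at most 1 in all, and the best
request matches the mass up to a constant factor. -/
theorem IsOptimalPrefixFree.coding_theorem {V : Machine} (hV : IsOptimalPrefixFree V)
    {Q : List Bool → List Bool → Prop} (hQ : PrimrecRel Q)
    (huniq : ∀ w t t', Q w t → Q w t' → t = t') :
    ∃ d, ∀ (t : List Bool) (F : Finset (List Bool)), (∀ w ∈ F, Q w t) →
      ∑ w ∈ F, (1 / 2 : ℝ) ^ strComplexity V w ≤ 2 ^ d * (1 / 2) ^ strComplexity V t := by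
  classical
  have hV0 : Partrec fun p => V p [] := hV.1.1.comp Computable.id (Computable.const [])
  obtain ⟨S, hS, hSmono, hSspec⟩ := hV0.exists_stages
  let good : ℕ → List Bool → List Bool → Prop := fun s t p => ∃ w ∈ (S s p).toList, Q w t
  have hgood_iff : ∀ s t p, good s t p ↔ ∃ w, S s p = some w ∧ Q w t := by
    intro s t p
    simp [good]
  have hgood : PrimrecRel fun (a : ℕ × List Bool) p => good a.1 a.2 p := by
    refine PrimrecPred.exists_mem (Primrec.optionToList.comp (hS.comp (Primrec.fst.comp Primrec.fst)
      Primrec.snd)) ?_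
    exact hQ.comp Primrec.snd (Primrec.snd.comp (Primrec.fst.comp Primrec.fst))
  let L : ℕ → List Bool → List (List Bool) := fun s t => (strsLe s).filter fun p => good s t p
  have hL : Primrec₂ L :=
    Primrec.list_filter (primrec_strsLe.comp Primrec.fst) hgood
  let num : ℕ → List Bool → ℕ := fun s t => ((L s t).map fun p => 2 ^ (s - p.length)).sum
  have hnum : Primrec₂ num := by
    refine Primrec.list_sum_map hL ?_
    exact Primrec.nat_pow.comp (Primrec.const 2) (Primrec.nat_sub.comp
      (Primrec.fst.comp Primrec.fst) (Primrec.list_length.comp Primrec.snd))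
  let mass : ℕ → List Bool → ℝ := fun s t => ∑ p ∈ (L s t).toFinset, (1 / 2 : ℝ) ^ p.length
  have hmem : ∀ s t p, p ∈ (L s t).toFinset ↔ p.length ≤ s ∧ good s t p := by
    intro s t p
    simp [L]
  have hnum_eq : ∀ s t, (num s t : ℝ) = 2 ^ s * mass s t := by
    intro s t
    have hnd : (L s t).Nodup := (nodup_strsLe s).filter _
    simp only [num, mass]
    rw [← List.sum_toFinset _ hnd, Finset.mul_sum]
    push_cast
    refine Finset.sum_congr rfl fun p hp => ?_
    obtain ⟨k, hk⟩ := Nat.exists_eq_add_of_le ((hmem s t p).1 hp).1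
    rw [hk, Nat.add_sub_cancel_left, pow_add, mul_right_comm, ← mul_pow]
    norm_num
  have hgmono : ∀ s s' t p, s ≤ s' → good s t p → good s' t p := by
    intro s s' t p hs h
    obtain ⟨w, h1, h2⟩ := (hgood_iff s t p).1 h
    exact (hgood_iff s' t p).2 ⟨w, hSmono s s' p w hs h1, h2⟩
  have hmass_mono : ∀ s s' t, s ≤ s' → mass s t ≤ mass s' t := by
    intro s s' t hs
    refine Finset.sum_le_sum_of_subset_of_nonneg ?_ fun _ _ _ => by positivity
    intro p hp
    rw [hmem] at hp ⊢
    exact ⟨hp.1.trans hs, hgmono s s' t p hs hp.2⟩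
  have hmass_sum : ∀ s (T : Finset (List Bool)), ∑ t ∈ T, mass s t ≤ 1 := by
    intro s T
    have hdisj : Set.PairwiseDisjoint (T : Set (List Bool)) fun t => (L s t).toFinset := by
      intro t _ t' _ htt'
      refine Finset.disjoint_left.2 fun p h1 h2 => htt' ?_
      rw [hmem, hgood_iff] at h1 h2
      obtain ⟨-, w, h1, h1'⟩ := h1
      obtain ⟨-, w', h2, h2'⟩ := h2
      rw [h1] at h2
      obtain rfl : w = w' := by simpa using h2
      exact huniq w t t' h1' h2'
    rw [← Finset.sum_biUnion hdisj]
    refine hV.1.2.sum_le_one fun p hp => ?_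
    obtain ⟨t, -, hp⟩ := Finset.mem_biUnion.1 hp
    rw [hmem, hgood_iff] at hp
    obtain ⟨-, w, hw, -⟩ := hp
    exact Part.dom_iff_mem.2 ⟨w, (hSspec p w).2 ⟨s, hw⟩⟩
  -- The factor 2 pays for the requests of the same t at all larger r.
  let P : ℕ → ℕ → List Bool → Prop := fun s r t => 2 * 2 ^ s ≤ num s t * 2 ^ r
  have hP_iff : ∀ s r t, P s r t ↔ (1 / 2 : ℝ) ^ r ≤ mass s t / 2 := by
    intro s r t
    have e1 : P s r t ↔ (2 : ℝ) * 2 ^ s ≤ num s t * 2 ^ r := by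
      simp only [P]; exact_mod_cast Iff.rfl
    rw [e1, hnum_eq]
    have hs : (0 : ℝ) < 2 ^ s := by positivity
    have hr : (0 : ℝ) < 2 ^ r := by positivity
    rw [one_div, inv_pow, inv_le_iff_one_le_mul₀ hr]
    constructor
    · intro h
      have := le_of_mul_le_mul_left
        (by linarith : (2 : ℝ) ^ s * 2 ≤ 2 ^ s * (mass s t * 2 ^ r)) hs
      linarith
    · intro h
      have := mul_le_mul_of_nonneg_left h hs.le
      linarith
  have hP : PrimrecPred fun a : ℕ × ℕ × List Bool => P a.1 a.2.1 a.2.2 := by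
    refine Primrec.nat_le.comp (Primrec.nat_mul.comp (Primrec.const 2) (Primrec.nat_pow.comp
      (Primrec.const 2) Primrec.fst)) (Primrec.nat_mul.comp (hnum.comp Primrec.fst
      (Primrec.snd.comp Primrec.snd)) (Primrec.nat_pow.comp (Primrec.const 2)
      (Primrec.fst.comp Primrec.snd)))
  have hPmono : ∀ s s' r t, s ≤ s' → P s r t → P s' r t := by
    intro s s' r t hs h
    rw [hP_iff] at h ⊢
    linarith [hmass_mono s s' t hs]
  obtain ⟨d, hd⟩ := hV.exists_strComplexity_le_of_kraft hP
    (fun s r t h => hPmono s (s + 1) r t s.le_succ h) (by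
      intro F hF
      choose! s hs using hF
      let N := F.sup s
      have hN : ∀ x ∈ F, (1 / 2 : ℝ) ^ x.1 ≤ mass N x.2 / 2 := fun x hx =>
        (hP_iff _ _ _).1 (hPmono (s x) N x.1 x.2 (Finset.le_sup hx) (hs x hx))
      calc ∑ x ∈ F, (1 / 2 : ℝ) ^ x.1
          = ∑ t ∈ F.image Prod.snd, ∑ x ∈ F with x.2 = t, (1 / 2 : ℝ) ^ x.1 :=
            (Finset.sum_fiberwise_of_maps_to (fun x hx => Finset.mem_image_of_mem _ hx) _).symm
        _ ≤ ∑ t ∈ F.image Prod.snd, mass N t := by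
            refine Finset.sum_le_sum fun t _ => ?_
            have e : ∑ x ∈ F with x.2 = t, (1 / 2 : ℝ) ^ x.1
                = ∑ r ∈ (F.filter fun x => x.2 = t).image Prod.fst, (1 / 2 : ℝ) ^ r := by
              rw [Finset.sum_image]
              rintro ⟨r, t1⟩ h1 ⟨r', t2⟩ h2 h
              simp only [Finset.coe_filter, Set.mem_ofPred_eq] at h1 h2 h
              rw [h, h1.2, h2.2]
            rw [e]
            have := sum_half_pow_le (R := (F.filter fun x => x.2 = t).image Prod.fst)
              (a := mass N t / 2) (div_nonneg (Finset.sum_nonneg fun _ _ => by positivity)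
                zero_le_two) (by
                intro r hr
                obtain ⟨x, hx, rfl⟩ := Finset.mem_image.1 hr
                rw [Finset.mem_filter] at hx
                rw [← hx.2]
                exact hN x hx.1)
            linarith
        _ ≤ 1 := hmass_sum N _)
  refine ⟨d + 2, fun t F hF => ?_⟩
  choose prog hprog1 hprog2 using fun w => exists_program (hV.complexity_ne_top w)
  have hstage : ∀ w, ∃ s, S s (prog w) = some w := fun w => (hSspec _ _).1 (hprog2 w)
  choose st hst using hstage
  let N := F.sup fun w => max (st w) (prog w).length
  have hinj : Set.InjOn prog F := by
    intro w _ w' _ h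
    exact Part.mem_unique (hprog2 w) (h ▸ hprog2 w')
  have hsub : F.image prog ⊆ (L N t).toFinset := by
    intro p hp
    obtain ⟨w, hw, rfl⟩ := Finset.mem_image.1 hp
    have h1 : max (st w) (prog w).length ≤ N :=
      Finset.le_sup (f := fun w => max (st w) (prog w).length) hw
    rw [hmem, hgood_iff]
    exact ⟨(le_max_right _ _).trans h1, w,
      hSmono _ _ _ _ ((le_max_left _ _).trans h1) (hst w), hF w hw⟩
  have hle : ∑ w ∈ F, (1 / 2 : ℝ) ^ strComplexity V w ≤ mass N t := by
    calc ∑ w ∈ F, (1 / 2 : ℝ) ^ strComplexity V w = ∑ p ∈ F.image prog, (1 / 2 : ℝ) ^ p.length := by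
          rw [Finset.sum_image hinj]
          exact Finset.sum_congr rfl fun w _ => by rw [hprog1]
      _ ≤ mass N t := Finset.sum_le_sum_of_subset_of_nonneg hsub fun _ _ _ => by positivity
  refine hle.trans ?_
  have hm1 : mass N t ≤ 1 := by simpa using hmass_sum N {t}
  by_cases hm0 : mass N t ≤ 0
  · exact hm0.trans (by positivity)
  · push Not at hm0
    have hex : ∃ r, (1 / 2 : ℝ) ^ r ≤ mass N t / 2 := by
      obtain ⟨r, hr⟩ := exists_pow_lt_of_lt_one (half_pos hm0) (by norm_num : (1 / 2 : ℝ) < 1)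
      exact ⟨r, hr.le⟩
    have hspec := Nat.find_spec hex
    -- The least r is positive since the mass is at most 1, and minimality gives mass < 4 * 2^-r;
    -- hence the 2 in `d + 2`.
    have hpos : Nat.find hex ≠ 0 := by
      intro h0
      rw [h0, pow_zero] at hspec
      linarith
    have hmin := Nat.find_min hex (Nat.sub_lt (Nat.pos_of_ne_zero hpos) one_pos)
    set r := Nat.find hex
    push Not at hmin
    have hk := hd N r t ((hP_iff _ _ _).2 hspec)
    have e1 : (1 / 2 : ℝ) ^ (r - 1) = 2 * (1 / 2) ^ r := by
      obtain ⟨k, hk⟩ := Nat.exists_eq_succ_of_ne_zero hpos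
      rw [hk, Nat.succ_sub_one, pow_succ]; ring
    have e2 : (1 / 2 : ℝ) ^ (r + d) ≤ (1 / 2) ^ strComplexity V t :=
      pow_le_pow_of_le_one (by norm_num) (by norm_num) hk
    have e3 : (2 : ℝ) ^ (d + 2) * (1 / 2) ^ (r + d) = 4 * (1 / 2) ^ r := by
      rw [pow_add, pow_add, show (2 : ℝ) ^ d * 2 ^ 2 * ((1 / 2) ^ r * (1 / 2) ^ d)
        = (2 * (1 / 2)) ^ d * (4 * (1 / 2) ^ r) by rw [mul_pow]; ring]
      norm_num
    have e4 := mul_le_mul_of_nonneg_left e2 (by positivity : (0 : ℝ) ≤ 2 ^ (d + 2))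
    linarith

/-! ### Composition of descriptions -/

/-- A shortest program of `w` followed by a string `q`, whose length is computable from `w`,
describes whatever is computable from `w`, `K(w)` and `q`. -/
theorem IsOptimalPrefixFree.exists_strComplexity_comp_le {V : Machine} (hV : IsOptimalPrefixFree V)
    {len : List Bool → ℕ} (hlen : Primrec len) {F : List Bool × ℕ × List Bool →. List Bool}
    (hF : Partrec F) :
    ∃ d, ∀ w q x, q.length = len w → x ∈ F (w, strComplexity V w, q) →
      strComplexity V x ≤ strComplexity V w + q.length + d := by
  have hV0 : Partrec fun p => V p [] := hV.1.1.comp Computable.id (Computable.const [])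
  obtain ⟨S, hS, -, hSspec⟩ := hV0.exists_stages
  -- The search index packs a split point and a stage. The length of the front part plays the role
  -- of K(w), and equals it when that part is a shortest program.
  let step : List Bool → ℕ → Option (List Bool × ℕ × List Bool) := fun P c =>
    (S c.unpair.2 (P.take c.unpair.1)).bind fun w =>
      if (P.drop c.unpair.1).length = len w then
        some (w, (P.take c.unpair.1).length, P.drop c.unpair.1) else none
  have hstep : ∀ P c a, step P c = some a ↔ S c.unpair.2 (P.take c.unpair.1) = some a.1 ∧
      (P.drop c.unpair.1).length = len a.1 ∧
      a.2 = ((P.take c.unpair.1).length, P.drop c.unpair.1) := by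
    rintro P c ⟨w, a⟩
    simp only [step, Option.bind_eq_some_iff, Option.ite_none_right_eq_some, Option.some.injEq,
      Prod.mk.injEq]
    constructor
    · rintro ⟨w', h1, h2, rfl, rfl⟩
      exact ⟨h1, h2, rfl⟩
    · rintro ⟨h1, h2, rfl⟩
      exact ⟨w, h1, h2, rfl, rfl⟩
  have hprim : Primrec₂ step := by
    have hj : Primrec fun a : List Bool × ℕ => a.2.unpair.1 :=
      Primrec.fst.comp (Primrec.unpair.comp Primrec.snd)
    have hs : Primrec fun a : List Bool × ℕ => a.2.unpair.2 :=
      Primrec.snd.comp (Primrec.unpair.comp Primrec.snd)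
    have htake : Primrec fun a : List Bool × ℕ => a.1.take a.2.unpair.1 :=
      Primrec.list_take.comp hj Primrec.fst
    have hdrop : Primrec fun a : List Bool × ℕ => a.1.drop a.2.unpair.1 :=
      Primrec.list_drop.comp hj Primrec.fst
    refine Primrec.option_bind (hS.comp hs htake) (Primrec.ite ?_ ?_ (Primrec.const none))
    · exact Primrec.eq.comp (Primrec.list_length.comp (hdrop.comp Primrec.fst))
        (hlen.comp Primrec.snd)
    · exact Primrec.option_some.comp (Primrec.pair Primrec.snd (Primrec.pair
        (Primrec.list_length.comp (htake.comp Primrec.fst)) (hdrop.comp Primrec.fst)))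
  have hmemV : ∀ P c a, step P c = some a → a.1 ∈ V (P.take c.unpair.1) [] := fun P c a h =>
    (hSspec _ _).2 ⟨_, ((hstep P c a).1 h).1⟩
  let W : Machine := fun P _ => (Nat.rfindOpt (step P)).bind F
  have hW : Partrec₂ W := by
    have h1 : Partrec fun P => Nat.rfindOpt (step P) := Partrec.rfindOpt hprim.to_comp
    have h2 : Partrec fun P => (Nat.rfindOpt (step P)).bind F :=
      h1.bind (hF.comp Computable.snd)
    exact h2.comp Computable.fst
  -- the split of a program into its two parts is unique
  have huniq : ∀ P P' c c' a a', P' <+: P → step P c = some a → step P' c' = some a' →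
      P.take c.unpair.1 = P'.take c'.unpair.1 ∧ a.1 = a'.1 := by
    intro P P' c c' a a' hpre h h'
    have m1 := hmemV P c a h
    have m2 := hmemV P' c' a' h'
    have e : P.take c.unpair.1 = P'.take c'.unpair.1 := by
      rcases List.prefix_or_prefix_of_prefix (List.take_prefix c.unpair.1 P)
        ((List.take_prefix c'.unpair.1 P').trans hpre) with h3 | h3
      · exact hV.1.2 _ _ [] (Part.dom_iff_mem.2 ⟨_, m2⟩) (Part.dom_iff_mem.2 ⟨_, m1⟩) h3
      · exact (hV.1.2 _ _ [] (Part.dom_iff_mem.2 ⟨_, m1⟩) (Part.dom_iff_mem.2 ⟨_, m2⟩) h3).symm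
    exact ⟨e, Part.mem_unique m1 (e ▸ m2)⟩
  have hW' : IsPrefixFree W := by
    intro P P' y hP hP' hpre
    obtain ⟨c, a, hc⟩ := Nat.rfindOpt_dom.1 (Part.Dom.of_bind hP)
    obtain ⟨c', a', hc'⟩ := Nat.rfindOpt_dom.1 (Part.Dom.of_bind hP')
    obtain ⟨e1, e2⟩ := huniq P P' c c' a a' hpre hc hc'
    obtain ⟨-, l1, -⟩ := (hstep P c a).1 hc
    obtain ⟨-, l2, -⟩ := (hstep P' c' a').1 hc'
    refine hpre.eq_of_length ?_
    rw [← List.take_append_drop c.unpair.1 P, ← List.take_append_drop c'.unpair.1 P',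
      List.length_append, List.length_append, e1, l1, l2, e2]
  obtain ⟨d, hd⟩ := hV.exists_strComplexity_le hW hW'
  refine ⟨d, fun w q x hq hx => ?_⟩
  obtain ⟨p, hp, hpw⟩ := exists_program (hV.complexity_ne_top w)
  obtain ⟨s, hs⟩ := (hSspec p w).1 hpw
  have h0 : step (p ++ q) (Nat.pair p.length s) = some (w, p.length, q) := by
    rw [hstep]
    simp [hs, hq]
  obtain ⟨a, ha⟩ := Part.dom_iff_mem.1 (Nat.rfindOpt_dom.2 ⟨_, _, h0⟩)
  obtain ⟨c, hc⟩ := Nat.rfindOpt_spec ha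
  obtain ⟨e1, e2⟩ := huniq (p ++ q) (p ++ q) c _ a _ (List.prefix_refl _) hc h0
  have haeq : a = (w, p.length, q) := by
    obtain ⟨-, -, h3⟩ := (hstep _ c a).1 hc
    have e4 : (p ++ q).take c.unpair.1 = p := by simpa using e1
    have e5 : (p ++ q).drop c.unpair.1 = q := by
      have := List.take_append_drop c.unpair.1 (p ++ q)
      rw [e4] at this
      exact List.append_cancel_left this
    rw [e4, e5] at h3
    exact Prod.ext e2 h3
  have := hd (p ++ q) x (Part.mem_bind_iff.2 ⟨_, haeq ▸ ha, hp ▸ hx⟩)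
  rw [List.length_append, hp] at this
  exact this

theorem primrec_replicate_true : Primrec fun n : ℕ => List.replicate n true :=
  (Primrec.list_map Primrec.list_range (Primrec₂.const true)).of_eq fun n => by
    simp [List.map_const']

/-- This crude bound, applied to group names, only serves to make K(w) small enough to index a
block. -/
theorem IsOptimalPrefixFree.exists_strComplexity_replicate_le {V : Machine}
    (hV : IsOptimalPrefixFree V) :
    ∃ d, ∀ n, strComplexity V (List.replicate n true) ≤ n + d := by
  obtain ⟨d, hd⟩ := hV.exists_strComplexity_le_of_kraft
    (P := fun _ r w => w.length + 1 = r ∧ w = List.replicate w.length true) (by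
      refine PrimrecPred.and (Primrec.eq.comp (Primrec.succ.comp (Primrec.list_length.comp
        (Primrec.snd.comp Primrec.snd))) (Primrec.fst.comp Primrec.snd))
        (Primrec.eq.comp (Primrec.snd.comp Primrec.snd) (primrec_replicate_true.comp
        (Primrec.list_length.comp (Primrec.snd.comp Primrec.snd)))))
    (fun s r w h => h) (by
      intro F hF
      have hinj : Set.InjOn Prod.fst (F : Set (ℕ × List Bool)) := by
        rintro ⟨r, w⟩ h ⟨r', w'⟩ h' (rfl : r = r')
        obtain ⟨-, h1, h2⟩ := hF _ h
        obtain ⟨-, h1', h2'⟩ := hF _ h'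
        simp only at h1 h2 h1' h2'
        have : w.length = w'.length := by omega
        rw [h2, h2', this]
      rw [← Finset.sum_image (f := fun r => (1 / 2 : ℝ) ^ r) hinj]
      refine (sum_half_pow_le (a := 1 / 2) (by norm_num) fun r hr => ?_).trans (by norm_num)
      obtain ⟨x, hx, rfl⟩ := Finset.mem_image.1 hr
      obtain ⟨-, h1, -⟩ := hF x hx
      rw [← h1, pow_succ]
      have : (1 / 2 : ℝ) ^ x.2.length ≤ 1 := pow_le_one₀ (by norm_num) (by norm_num)
      linarith)
  refine ⟨d + 1, fun n => ?_⟩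
  have := hd 0 (n + 1) (List.replicate n true) (by simp)
  omega

/-! ### The game -/

/-- The strings of length `(2 * T + 1) * 2 ^ m + 1` that end with a one. -/
def group (T m : ℕ) : List (List Bool) := (strs ((2 * T + 1) * 2 ^ m)).map (· ++ [true])

theorem mem_group {T m : ℕ} {w : List Bool} :
    w ∈ group T m ↔ ∃ y : List Bool, y.length = (2 * T + 1) * 2 ^ m ∧ y ++ [true] = w := by
  simp [group]

theorem nodup_group (T m : ℕ) : (group T m).Nodup :=
  (nodup_strs _).map (List.append_left_injective _)

/-- The logarithm of the number of candidates after `i` rounds. -/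
@[irreducible] def roundSize (T m i : ℕ) : ℕ := (2 * T + 1) * (2 ^ m - i)

/-- The bound on the complexity of the candidates after `i` rounds. -/
@[irreducible] def roundBound (T m k i : ℕ) : ℕ := k + m + roundSize T m i + T

theorem roundSize_succ {T m i : ℕ} (h : i < 2 ^ m) :
    roundSize T m i = roundSize T m (i + 1) + (2 * T + 1) := by
  obtain ⟨j, hj⟩ := Nat.exists_eq_add_of_lt h
  rw [roundSize, roundSize, hj, show i + j + 1 - i = j + 1 by omega,
    show i + j + 1 - (i + 1) = j by omega]
  ring

theorem roundBound_strictAnti {T m k i j : ℕ} (hij : i < j) (hj : j ≤ 2 ^ m) :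
    roundBound T m k j < roundBound T m k i := by
  have : roundSize T m j < roundSize T m i := by
    rw [roundSize, roundSize]
    exact Nat.mul_lt_mul_of_pos_left (by omega) (by omega)
  unfold roundBound
  omega

section Game

variable (R : (ℕ × ℕ) × ℕ × List Bool × ℕ → Prop)

/-- All candidates have revealed an admissible bound on their complexity by stage `s`. -/
def RoundReady (a : ℕ × ℕ × ℕ) (i : ℕ) (S : List (List Bool)) (s : ℕ) : Prop :=
  ∀ w ∈ S, ∃ v ∈ List.range (roundBound a.1 a.2.1 a.2.2 i + 1), R ((a.1, a.2.1), s, w, v)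

/-- The bound revealed by `w` is in the window of round `i`. -/
def InWindow (a : ℕ × ℕ × ℕ) (i s : ℕ) (w : List Bool) : Prop :=
  ∃ v ∈ List.range (roundBound a.1 a.2.1 a.2.2 i + 1),
    roundBound a.1 a.2.1 a.2.2 (i + 1) < v ∧ R ((a.1, a.2.1), s, w, v)

variable {R}

theorem primrec_group : Primrec₂ group := by
  refine Primrec.list_map (primrec_strs.comp (Primrec.nat_mul.comp
    (Primrec.nat_double_succ.comp Primrec.fst) (Primrec.nat_pow.comp (Primrec.const 2)
    Primrec.snd))) ?_
  exact Primrec.list_append.comp Primrec.snd (Primrec.const [true])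

theorem primrec_roundSize {α : Type*} [Primcodable α] {T m i : α → ℕ} (hT : Primrec T)
    (hm : Primrec m) (hi : Primrec i) : Primrec fun x => roundSize (T x) (m x) (i x) :=
  (Primrec.nat_mul.comp (Primrec.nat_double_succ.comp hT) (Primrec.nat_sub.comp
    (Primrec.nat_pow.comp (Primrec.const 2) hm) hi)).of_eq fun _ => by rw [roundSize]

theorem primrec_roundBound {α : Type*} [Primcodable α] {a : α → ℕ × ℕ × ℕ} {i : α → ℕ}
    (ha : Primrec a) (hi : Primrec i) :
    Primrec fun x => roundBound (a x).1 (a x).2.1 (a x).2.2 (i x) := by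
  have h1 := Primrec.fst.comp ha
  have h2 := Primrec.fst.comp (Primrec.snd.comp ha)
  have h3 := Primrec.snd.comp (Primrec.snd.comp ha)
  exact (Primrec.nat_add.comp (Primrec.nat_add.comp (Primrec.nat_add.comp h3 h2)
    (primrec_roundSize h1 h2 hi)) h1).of_eq fun _ => by rw [roundBound]

theorem primrec_request {α : Type*} [Primcodable α] {a : α → ℕ × ℕ × ℕ} {s : α → ℕ}
    {w : α → List Bool} {v : α → ℕ} (ha : Primrec a) (hs : Primrec s) (hw : Primrec w)
    (hv : Primrec v) : Primrec fun x => (((a x).1, (a x).2.1), s x, w x, v x) :=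
  Primrec.pair (Primrec.pair (Primrec.fst.comp ha) (Primrec.fst.comp (Primrec.snd.comp ha)))
    (Primrec.pair hs (Primrec.pair hw hv))

theorem primrec_inWindow (hR : PrimrecPred R) {α : Type*} [Primcodable α] {a : α → ℕ × ℕ × ℕ}
    {i s : α → ℕ} {w : α → List Bool} (ha : Primrec a) (hi : Primrec i) (hs : Primrec s)
    (hw : Primrec w) : PrimrecPred fun x => InWindow R (a x) (i x) (s x) (w x) := by
  refine PrimrecPred.exists_mem (Primrec.list_range.comp (Primrec.succ.comp
    (primrec_roundBound ha hi))) (PrimrecPred.and ?_ ?_)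
  · exact Primrec.nat_lt.comp (primrec_roundBound (ha.comp Primrec.fst)
      (Primrec.succ.comp (hi.comp Primrec.fst))) Primrec.snd
  · exact hR.comp (primrec_request (ha.comp Primrec.fst) (hs.comp Primrec.fst)
      (hw.comp Primrec.fst) Primrec.snd)

theorem primrec_roundReady (hR : PrimrecPred R) {α : Type*} [Primcodable α] {a : α → ℕ × ℕ × ℕ}
    {i s : α → ℕ} {S : α → List (List Bool)} (ha : Primrec a) (hi : Primrec i) (hS : Primrec S)
    (hs : Primrec s) : PrimrecPred fun x => RoundReady R (a x) (i x) (S x) (s x) := by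
  refine PrimrecPred.forall_mem hS (PrimrecPred.exists_mem (Primrec.list_range.comp
    (Primrec.succ.comp (primrec_roundBound (ha.comp Primrec.fst) (hi.comp Primrec.fst)))) ?_)
  exact hR.comp (primrec_request (ha.comp (Primrec.fst.comp Primrec.fst))
    (hs.comp (Primrec.fst.comp Primrec.fst)) (Primrec.snd.comp Primrec.fst) Primrec.snd)

variable (R) [DecidablePred R]

instance (a : ℕ × ℕ × ℕ) (i : ℕ) (S : List (List Bool)) (s : ℕ) :
    Decidable (RoundReady R a i S s) := by unfold RoundReady; infer_instance

instance (a : ℕ × ℕ × ℕ) (i s : ℕ) (w : List Bool) : Decidable (InWindow R a i s w) := by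
  unfold InWindow; infer_instance

/-- The majority among the candidates inside and those outside of the window. -/
def majority (a : ℕ × ℕ × ℕ) (i : ℕ) (S : List (List Bool)) (s : ℕ) : List (List Bool) :=
  if S.length ≤ 2 * (S.filter fun w => InWindow R a i s w).length
  then S.filter fun w => InWindow R a i s w
  else S.filter fun w => ¬ InWindow R a i s w

/-- The candidates after round `i`. -/
def nextRound (a : ℕ × ℕ × ℕ) (i : ℕ) (S : List (List Bool)) : Part (List (List Bool)) :=
  (Nat.rfind fun s => Part.some (decide (RoundReady R a i S s))).map fun s =>
    (majority R a i S s).take (2 ^ roundSize a.1 a.2.1 (i + 1))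

/-- The candidates before round `i`. -/
def candidates (a : ℕ × ℕ × ℕ) (i : ℕ) : Part (List (List Bool)) :=
  Nat.rec (Part.some (group a.1 a.2.1)) (fun i IH => IH.bind fun S => nextRound R a i S) i

variable {R}

theorem primrec_majority (hR : PrimrecPred R) {α : Type*} [Primcodable α] {a : α → ℕ × ℕ × ℕ}
    {i s : α → ℕ} {S : α → List (List Bool)} (ha : Primrec a) (hi : Primrec i) (hS : Primrec S)
    (hs : Primrec s) : Primrec fun x => majority R (a x) (i x) (S x) (s x) := by
  have hw : PrimrecRel fun (x : α) w => InWindow R (a x) (i x) (s x) w :=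
    primrec_inWindow hR (ha.comp Primrec.fst) (hi.comp Primrec.fst) (hs.comp Primrec.fst)
      Primrec.snd
  have hf := Primrec.list_filter hS hw
  exact Primrec.ite (Primrec.nat_le.comp (Primrec.list_length.comp hS)
    (Primrec.nat_mul.comp (Primrec.const 2) (Primrec.list_length.comp hf))) hf
    (Primrec.list_filter hS hw.not)

theorem partrec_nextRound (hR : PrimrecPred R) {α : Type*} [Primcodable α] {a : α → ℕ × ℕ × ℕ}
    {i : α → ℕ} {S : α → List (List Bool)} (ha : Primrec a) (hi : Primrec i) (hS : Primrec S) :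
    Partrec fun x => nextRound R (a x) (i x) (S x) := by
  refine Partrec.map (Partrec.rfind ?_) (Primrec.to_comp ?_)
  · exact (primrec_roundReady hR (ha.comp Primrec.fst) (hi.comp Primrec.fst)
      (hS.comp Primrec.fst) Primrec.snd).decide.to_comp.partrec
  · exact Primrec.list_take.comp (Primrec.nat_pow.comp (Primrec.const 2)
      (primrec_roundSize (Primrec.fst.comp (ha.comp Primrec.fst))
        (Primrec.fst.comp (Primrec.snd.comp (ha.comp Primrec.fst)))
        (Primrec.succ.comp (hi.comp Primrec.fst))))
      (primrec_majority hR (ha.comp Primrec.fst) (hi.comp Primrec.fst)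
        (hS.comp Primrec.fst) Primrec.snd)

theorem partrec_candidates (hR : PrimrecPred R) {α : Type*} [Primcodable α] {a : α → ℕ × ℕ × ℕ}
    {i : α → ℕ} (ha : Primrec a) (hi : Primrec i) : Partrec fun x => candidates R (a x) (i x) := by
  have h0 : Computable fun x => group (a x).1 (a x).2.1 :=
    (primrec_group.comp (Primrec.fst.comp ha) (Primrec.fst.comp (Primrec.snd.comp ha))).to_comp
  have h1 : Partrec₂ fun (x : α) (p : ℕ × List (List Bool)) => nextRound R (a x) p.1 p.2 :=
    partrec_nextRound hR (ha.comp Primrec.fst) (Primrec.fst.comp Primrec.snd)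
      (Primrec.snd.comp Primrec.snd)
  exact (Partrec.nat_rec hi.to_comp h0.partrec h1).of_eq fun _ => rfl

theorem length_le_two_mul_majority (a : ℕ × ℕ × ℕ) (i : ℕ) (S : List (List Bool)) (s : ℕ) :
    S.length ≤ 2 * (majority R a i S s).length := by
  unfold majority
  split_ifs with h
  · exact h
  · have := List.length_eq_length_filter_add (l := S) fun w => decide (InWindow R a i s w)
    simp only [decide_not]
    omega

theorem majority_sublist (a : ℕ × ℕ × ℕ) (i : ℕ) (S : List (List Bool)) (s : ℕ) :
    (majority R a i S s).Sublist S := by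
  unfold majority
  split_ifs <;> exact List.filter_sublist

/-- One round: the candidates are cut down to a part that reveals a bound in the window, unless
at least half of them reveal a bound below the window. -/
theorem exists_mem_nextRound
    (hmono : ∀ t s s' w v, s ≤ s' → R (t, s, w, v) → R (t, s', w, v))
    {T m k i : ℕ} (hi : i < 2 ^ m) {S : List (List Bool)}
    (hlen : S.length = 2 ^ roundSize T m i)
    (hS : ∀ w ∈ S, ∃ v ≤ roundBound T m k i, ∃ s, R ((T, m), s, w, v)) :
    ∃ S' ∈ nextRound R (T, m, k) i S, S'.Sublist S ∧ S'.length = 2 ^ roundSize T m (i + 1) ∧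
      ((∀ w ∈ S', ∃ v ≤ roundBound T m k i, roundBound T m k (i + 1) < v ∧
          ∃ s, R ((T, m), s, w, v)) ∨
        ∃ X : List (List Bool), X.Sublist S ∧ S.length ≤ 2 * X.length ∧
          ∀ w ∈ X, ∃ v ≤ roundBound T m k (i + 1), ∃ s, R ((T, m), s, w, v)) := by
  have hready : ∃ s, RoundReady R (T, m, k) i S s := by
    choose! v hv s hs using hS
    refine ⟨S.toFinset.sup s, fun w hw => ⟨v w, ?_, ?_⟩⟩
    · exact List.mem_range.2 (Nat.lt_succ_of_le (hv w hw))
    · exact hmono _ _ _ _ _ (Finset.le_sup (List.mem_toFinset.2 hw)) (hs w hw)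
  obtain ⟨s0, hs0⟩ := hready
  obtain ⟨s, hs, -⟩ := Nat.rfind_min' (p := fun s => decide (RoundReady R (T, m, k) i S s))
    (m := s0) (by simpa using hs0)
  have hsr : RoundReady R (T, m, k) i S s := by simpa using Nat.rfind_spec hs
  refine ⟨_, Part.mem_map _ hs, (List.take_sublist _ _).trans (majority_sublist _ _ _ _), ?_, ?_⟩
  -- The majority has at least 2^(2T) times the size kept, so the cut leaves exactly 2 ^ `roundSize`
  -- candidates, each named by an index of `roundSize` bits.
  · have h1 := length_le_two_mul_majority (R := R) (T, m, k) i S s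
    rw [hlen, roundSize_succ hi, pow_add, pow_succ] at h1
    have h2 := Nat.one_le_two_pow (n := 2 * T)
    rw [List.length_take, min_eq_left]
    have h3 := Nat.mul_le_mul_left (2 ^ roundSize T m (i + 1)) h2
    dsimp only
    rw [← mul_assoc] at h1
    omega
  · by_cases h : S.length ≤ 2 * (S.filter fun w => InWindow R (T, m, k) i s w).length
    · left
      intro w hw
      have hw' := List.mem_of_mem_take hw
      rw [majority, if_pos h, List.mem_filter, decide_eq_true_iff] at hw'
      obtain ⟨-, v, hv, hv', hR⟩ := hw'
      exact ⟨v, Nat.lt_succ_iff.1 (List.mem_range.1 hv), hv', s, hR⟩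
    -- Here the majority is taken before the cut: the factor 2^(2T) that the cut discards is what
    -- makes a miss heavy.
    · right
      refine ⟨majority R (T, m, k) i S s, majority_sublist _ _ _ _,
        length_le_two_mul_majority _ _ _ _, fun w hw => ?_⟩
      rw [majority, if_neg h, List.mem_filter, decide_eq_true_iff] at hw
      obtain ⟨v, hv, hR⟩ := hsr w hw.1
      refine ⟨v, ?_, s, hR⟩
      by_contra hlt
      exact hw.2 ⟨v, hv, not_le.1 hlt, hR⟩

end Game

/-- The length of a member thus determines both T and m, which makes all groups disjoint. -/
theorem odd_mul_two_pow_injective {a b m n : ℕ} (h : (2 * a + 1) * 2 ^ m = (2 * b + 1) * 2 ^ n) :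
    a = b ∧ m = n := by
  induction m generalizing n with
  | zero =>
    cases n with
    | zero => simp at h; omega
    | succ n => rw [pow_succ, ← mul_assoc] at h; omega
  | succ m ih =>
    cases n with
    | zero => rw [pow_succ, ← mul_assoc] at h; omega
    | succ n =>
      rw [pow_succ, pow_succ, ← mul_assoc, ← mul_assoc] at h
      obtain ⟨h1, h2⟩ := ih (Nat.eq_of_mul_eq_mul_right two_pos h)
      exact ⟨h1, by rw [h2]⟩

/-- The name of the group with parameters `T` and `m`. -/
def groupName (T m : ℕ) : List Bool := List.replicate (Encodable.encode (T, m)) true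

/-- The coding theorem is applied to the map from a member to the name of its group. As T is part of
the name, the constant is uniform in T, which can be chosen after it. -/
theorem IsOptimalPrefixFree.exists_sum_group_le {V : Machine} (hV : IsOptimalPrefixFree V) :
    ∃ d, ∀ T m (F : Finset (List Bool)), (∀ w ∈ F, w ∈ group T m) →
      ∑ w ∈ F, (1 / 2 : ℝ) ^ strComplexity V w ≤ 2 ^ d * (1 / 2) ^ strComplexity V (groupName T m)
    := by
  let par : List Bool → ℕ × ℕ := fun t => Denumerable.ofNat (ℕ × ℕ) t.length
  have hpar : Primrec par := (Primrec.ofNat (ℕ × ℕ)).comp Primrec.list_length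
  have hQ : PrimrecRel fun (w t : List Bool) =>
      w.length = (2 * (par t).1 + 1) * 2 ^ (par t).2 + 1 ∧ t = List.replicate t.length true := by
    have ht : Primrec fun x : List Bool × List Bool => par x.2 := hpar.comp Primrec.snd
    refine PrimrecPred.and (Primrec.eq.comp (Primrec.list_length.comp Primrec.fst)
      (Primrec.succ.comp (Primrec.nat_mul.comp (Primrec.nat_double_succ.comp (Primrec.fst.comp ht))
        (Primrec.nat_pow.comp (Primrec.const 2) (Primrec.snd.comp ht)))))
      (Primrec.eq.comp Primrec.snd (primrec_replicate_true.comp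
        (Primrec.list_length.comp Primrec.snd)))
  obtain ⟨d, hd⟩ := hV.coding_theorem hQ (by
    rintro w t t' ⟨h1, h2⟩ ⟨h1', h2'⟩
    obtain ⟨e1, e2⟩ := odd_mul_two_pow_injective (Nat.succ_injective (h1.symm.trans h1'))
    have e : t.length = t'.length := by
      have := congrArg Encodable.encode (Prod.ext e1 e2 : par t = par t')
      simpa only [par, Denumerable.encode_ofNat] using this
    rw [h2, h2', e])
  refine ⟨d, fun T m F hF => hd _ F fun w hw => ?_⟩
  obtain ⟨y, hy, rfl⟩ := mem_group.1 (hF w hw)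
  simp [groupName, par, hy]

section Game

variable {R : (ℕ × ℕ) × ℕ × List Bool × ℕ → Prop} [DecidablePred R]

/-- The candidates before round `i` have complexity within the bound of that round. -/
theorem IsOptimalPrefixFree.exists_candidate_bound {V : Machine} (hV : IsOptimalPrefixFree V)
    (hR : PrimrecPred R) :
    ∃ d, ∀ T m i, i < 2 ^ m → ∀ S ∈ candidates R (T, m, strComplexity V (groupName T m)) i,
      S.length = 2 ^ roundSize T m i → ∀ w ∈ S,
        strComplexity V w ≤ strComplexity V (groupName T m) + m + roundSize T m i + d := by
  let par : List Bool → ℕ × ℕ := fun t => Denumerable.ofNat (ℕ × ℕ) t.length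
  have hpar : Primrec par := (Primrec.ofNat (ℕ × ℕ)).comp Primrec.list_length
  let par' : List Bool → (ℕ × ℕ × ℕ) × ℕ := fun t => Denumerable.ofNat _ t.length
  have hpar' : Primrec par' := (Primrec.ofNat _).comp Primrec.list_length
  let name : (ℕ × ℕ × ℕ) × ℕ → List Bool := fun a => List.replicate (Encodable.encode a) true
  have hname : Primrec name := primrec_replicate_true.comp Primrec.encode
  -- A shortest program of the group's name supplies T, m and, by its length, k; m further bits give
  -- the round number.
  obtain ⟨d1, hd1⟩ := hV.exists_strComplexity_comp_le (len := fun t => (par t).2)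
    (Primrec.snd.comp hpar)
    (F := fun x => Part.some (name (((par x.1).1, (par x.1).2, x.2.1), beVal x.2.2))) (by
      have h1 : Primrec fun x : List Bool × ℕ × List Bool => par x.1 := hpar.comp Primrec.fst
      exact (hname.comp (Primrec.pair (Primrec.pair (Primrec.fst.comp h1)
        (Primrec.pair (Primrec.snd.comp h1) (Primrec.fst.comp Primrec.snd)))
        (primrec_beVal.comp (Primrec.snd.comp Primrec.snd)))).to_comp.partrec)
  -- These data determine the list of candidates; `roundSize` further bits give a position in it.
  obtain ⟨d2, hd2⟩ := hV.exists_strComplexity_comp_le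
    (len := fun t => roundSize (par' t).1.1 (par' t).1.2.1 (par' t).2)
    (primrec_roundSize (Primrec.fst.comp (Primrec.fst.comp hpar'))
      (Primrec.fst.comp (Primrec.snd.comp (Primrec.fst.comp hpar'))) (Primrec.snd.comp hpar'))
    (F := fun x => (candidates R (par' x.1).1 (par' x.1).2).map fun S => S.getD (beVal x.2.2) [])
    (by
      have h1 : Primrec fun x : List Bool × ℕ × List Bool => par' x.1 := hpar'.comp Primrec.fst
      refine Partrec.map (partrec_candidates hR (Primrec.fst.comp h1) (Primrec.snd.comp h1))
        (Primrec.to_comp ?_)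
      exact (Primrec.list_getD []).comp Primrec.snd (primrec_beVal.comp
        (Primrec.snd.comp (Primrec.snd.comp Primrec.fst))))
  refine ⟨d1 + d2, fun T m i hi S hS hlen w hw => ?_⟩
  have hpn : par (groupName T m) = (T, m) := by simp [par, groupName]
  have hpn' : ∀ a, par' (name a) = a := fun a => by
    simp only [par', name, List.length_replicate, Denumerable.ofNat_encode]
  obtain ⟨q, hq, hqv⟩ := exists_beVal m i hi
  have k1 := hd1 (groupName T m) q (name ((T, m, strComplexity V (groupName T m)), i))
    (by rw [hpn, hq]) (by simp [hpn, hqv])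
  obtain ⟨n, hn, rfl⟩ := List.getElem_of_mem hw
  obtain ⟨q', hq', hqv'⟩ := exists_beVal (roundSize T m i) n (hlen ▸ hn)
  have k2 := hd2 (name ((T, m, strComplexity V (groupName T m)), i)) q' S[n]
    (by rw [hpn', hq']) (by
      simp only [hpn']
      refine (Part.mem_map_iff _).2 ⟨S, hS, ?_⟩
      simp [hqv', hn])
  omega

/-- If the group members reveal few bounds on their complexity, one of them does not reveal its
complexity. -/
theorem IsOptimalPrefixFree.exists_mem_group {V : Machine} (hV : IsOptimalPrefixFree V)
    (hR : PrimrecPred R) (hmono : ∀ t s s' w v, s ≤ s' → R (t, s, w, v) → R (t, s', w, v))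
    (hRK : ∀ t s w v, R (t, s, w, v) → strComplexity V w ≤ v) :
    ∃ T₀, ∀ T ≥ T₀, ∀ m,
      (∀ w ∈ group T m, ∀ F : Finset ℕ, (∀ v ∈ F, ∃ s, R ((T, m), s, w, v)) →
        4 * F.card ≤ 2 ^ m) →
      ∃ w ∈ group T m, ∀ s, ¬ R ((T, m), s, w, strComplexity V w) := by
  classical
  obtain ⟨d, hd⟩ := hV.exists_candidate_bound hR
  obtain ⟨e, he⟩ := hV.exists_sum_group_le
  -- The term d puts the complexity of candidates within `roundBound`; e + 3 makes 2^T at least 4 *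
  -- 2^(e+1), as the count of misses needs.
  refine ⟨d + e + 3, fun T hT m hcard => ?_⟩
  by_contra hcon
  push Not at hcon
  set k := strComplexity V (groupName T m) with hk
  have inv : ∀ i ≤ 2 ^ m, ∃ S ∈ candidates R (T, m, k) i, S.Sublist (group T m) ∧
      S.length = 2 ^ roundSize T m i := by
    intro i
    induction i with
    | zero =>
      intro _
      exact ⟨group T m, Part.mem_some _, List.Sublist.refl _, by simp [group, roundSize]⟩
    | succ i ih =>
      intro hi
      obtain ⟨S, hS, hsub, hlen⟩ := ih (by omega)
      obtain ⟨S', hS', h1, h2, -⟩ := exists_mem_nextRound (k := k) hmono (T := T) (m := m) (i := i)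
        (by omega) hlen (fun w hw => ⟨strComplexity V w, by
          have := hd T m i (by omega) S hS hlen w hw
          unfold roundBound
          omega, hcon w (hsub.subset hw)⟩)
      exact ⟨S', Part.mem_bind hS hS', h1.trans hsub, h2⟩
  choose! S hS hsub hlen using inv
  have round : ∀ i < 2 ^ m, (S (i + 1)).Sublist (S i) ∧
      ((∀ w ∈ S (i + 1), ∃ v ≤ roundBound T m k i, roundBound T m k (i + 1) < v ∧
          ∃ s, R ((T, m), s, w, v)) ∨
        ∃ X : List (List Bool), X.Sublist (S i) ∧ (S i).length ≤ 2 * X.length ∧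
          ∀ w ∈ X, strComplexity V w ≤ roundBound T m k (i + 1)) := by
    intro i hi
    obtain ⟨S', hS', h1, -, h2⟩ := exists_mem_nextRound (k := k) hmono hi (hlen i hi.le)
      (fun w hw => ⟨strComplexity V w, by
        have := hd T m i hi (S i) (hS i hi.le) (hlen i hi.le) w hw
        unfold roundBound
        omega, hcon w ((hsub i hi.le).subset hw)⟩)
    obtain rfl : S' = S (i + 1) :=
      Part.mem_unique (Part.mem_bind (hS i hi.le) hS') (hS (i + 1) hi)
    refine ⟨h1, h2.imp id ?_⟩
    rintro ⟨X, hX, hX2, hX3⟩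
    refine ⟨X, hX, hX2, fun w hw => ?_⟩
    obtain ⟨v, hv, s, hs⟩ := hX3 w hw
    exact (hRK _ _ _ _ hs).trans hv
  obtain ⟨Hit, hHit⟩ : ∃ Hit : ℕ → Prop, ∀ i, Hit i ↔
      ∀ w ∈ S (i + 1), ∃ v ≤ roundBound T m k i, roundBound T m k (i + 1) < v ∧
        ∃ s, R ((T, m), s, w, v) := ⟨_, fun _ => Iff.rfl⟩
  simp only [← hHit] at round
  let hits := (Finset.range (2 ^ m)).filter Hit
  let misses := (Finset.range (2 ^ m)).filter fun i => ¬ Hit i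
  have htotal : hits.card + misses.card = 2 ^ m := by
    have := Finset.card_filter_add_card_filter_not (s := Finset.range (2 ^ m)) Hit
    rwa [Finset.card_range] at this
  -- A survivor of all rounds reveals a value in the window of each hit, and the windows are
  -- disjoint.
  have hhits : 4 * hits.card ≤ 2 ^ m := by
    have hl := hlen (2 ^ m) le_rfl
    have hne : S (2 ^ m) ≠ [] := by
      intro h
      rw [h] at hl
      exact absurd hl.symm (by simp)
    obtain ⟨w, hw⟩ := List.exists_mem_of_ne_nil _ hne
    have hwS : ∀ j ≤ 2 ^ m, w ∈ S (2 ^ m - j) := by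
      intro j
      induction j with
      | zero => intro _; exact hw
      | succ j ih =>
        intro hj
        have h1 := (round (2 ^ m - (j + 1)) (by omega)).1
        rw [show 2 ^ m - (j + 1) + 1 = 2 ^ m - j by omega] at h1
        exact h1.subset (ih (by omega))
    have hwin : ∀ i ∈ hits, ∃ v ≤ roundBound T m k i, roundBound T m k (i + 1) < v ∧
        ∃ s, R ((T, m), s, w, v) := by
      intro i hi
      obtain ⟨hi1, hi2⟩ := Finset.mem_filter.1 hi
      rw [Finset.mem_range] at hi1
      have := hwS (2 ^ m - (i + 1)) (by omega)
      rw [show 2 ^ m - (2 ^ m - (i + 1)) = i + 1 by omega] at this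
      exact (hHit i).1 hi2 w this
    choose! v hv1 hv2 hv3 using hwin
    have hlt : ∀ i ∈ hits, ∀ j ∈ hits, i < j → v j < v i := by
      intro i hi j hj hij
      have h1 : roundBound T m k j ≤ roundBound T m k (i + 1) := by
        rcases Nat.eq_or_lt_of_le (Nat.succ_le_of_lt hij) with h | h
        · exact le_of_eq (by rw [← h])
        · exact (roundBound_strictAnti h
            (Finset.mem_range.1 (Finset.mem_filter.1 hj).1).le).le
      have := hv1 j hj
      have := hv2 i hi
      omega
    have hinj : Set.InjOn v hits := by
      intro i hi j hj hij
      rcases lt_trichotomy i j with h | h | h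
      · exact absurd hij (hlt i hi j hj h).ne'
      · exact h
      · exact absurd hij (hlt j hj i hi h).ne
    rw [← Finset.card_image_of_injOn hinj]
    refine hcard w ((hsub _ le_rfl).subset hw) _ fun x hx => ?_
    obtain ⟨i, hi, rfl⟩ := Finset.mem_image.1 hx
    exact hv3 i hi
  have hmisses : 4 * misses.card ≤ 2 ^ m := by
    let G := (group T m).toFinset
    have hX : ∀ i ∈ misses, (2 : ℝ) ^ roundSize T m i ≤
        2 * ((G.filter fun w => strComplexity V w ≤ roundBound T m k (i + 1)).card : ℝ) := by
      intro i hi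
      obtain ⟨hi1, hi2⟩ := Finset.mem_filter.1 hi
      rw [Finset.mem_range] at hi1
      obtain ⟨X, hX1, hX2, hX3⟩ := (round i hi1).2.resolve_left hi2
      rw [hlen i hi1.le] at hX2
      have hXsub := hX1.trans (hsub i hi1.le)
      have hle : X.length ≤
          (G.filter fun w => strComplexity V w ≤ roundBound T m k (i + 1)).card := by
        rw [← List.toFinset_card_of_nodup ((nodup_group T m).sublist hXsub)]
        refine Finset.card_le_card fun w hw => ?_
        rw [List.mem_toFinset] at hw
        exact Finset.mem_filter.2 ⟨List.mem_toFinset.2 (hXsub.subset hw), hX3 w hw⟩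
      exact_mod_cast hX2.trans (Nat.mul_le_mul_left 2 hle)
    -- At least 2^(`roundSize` + 2T) strings, each counted with weight 2^-(k + m + `roundSize` + T),
    -- where `roundSize` is taken at i + 1.
    have hweight : ∀ i ∈ misses, (2 : ℝ) ^ T * (1 / 2) ^ (k + m) ≤
        ∑ w ∈ G with strComplexity V w ≤ roundBound T m k (i + 1),
          (1 / 2 : ℝ) ^ roundBound T m k (i + 1) := by
      intro i hi
      have hi1 := Finset.mem_range.1 (Finset.mem_filter.1 hi).1
      have h1 := hX i hi
      rw [Finset.sum_const, nsmul_eq_mul]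
      rw [roundSize_succ hi1] at h1
      have hp : (0 : ℝ) < (1 / 2) ^ roundBound T m k (i + 1) := by positivity
      have h2 := mul_le_mul_of_nonneg_right h1 hp.le
      have h3 : (2 : ℝ) ^ (roundSize T m (i + 1) + (2 * T + 1)) *
          (1 / 2) ^ roundBound T m k (i + 1) = 2 * (2 ^ T * (1 / 2) ^ (k + m)) := by
        rw [roundBound, show roundSize T m (i + 1) + (2 * T + 1)
          = roundSize T m (i + 1) + T + (T + 1) by ring,
          show k + m + roundSize T m (i + 1) + T = (k + m) + (roundSize T m (i + 1) + T) by ring,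
          pow_add (2 : ℝ) (roundSize T m (i + 1) + T), pow_add (1 / 2 : ℝ) (k + m)]
        have : (2 : ℝ) ^ (roundSize T m (i + 1) + T) * (1 / 2) ^ (roundSize T m (i + 1) + T) = 1 := by
          rw [← mul_pow]; norm_num
        rw [pow_succ (2 : ℝ) T]
        linear_combination (2 ^ T * 2 * (1 / 2 : ℝ) ^ (k + m)) * this
      linarith
    -- A string may count for several misses, but with distinct exponents not below its complexity,
    -- so in total at most twice its weight.
    have hupper : ∑ i ∈ misses, ∑ w ∈ G with strComplexity V w ≤ roundBound T m k (i + 1),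
        (1 / 2 : ℝ) ^ roundBound T m k (i + 1) ≤ 2 * (2 ^ e * (1 / 2) ^ k) := by
      have hswap : ∑ i ∈ misses, ∑ w ∈ G with strComplexity V w ≤ roundBound T m k (i + 1),
          (1 / 2 : ℝ) ^ roundBound T m k (i + 1) =
          ∑ w ∈ G, ∑ i ∈ misses with strComplexity V w ≤ roundBound T m k (i + 1),
            (1 / 2 : ℝ) ^ roundBound T m k (i + 1) := by
        simp only [Finset.sum_filter]
        exact Finset.sum_comm
      rw [hswap]
      refine le_trans (Finset.sum_le_sum (g := fun w => 2 * (1 / 2 : ℝ) ^ strComplexity V w) ?_) ?_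
      · intro w _
        have hinj : Set.InjOn (fun i => roundBound T m k (i + 1))
            (misses.filter fun i => strComplexity V w ≤ roundBound T m k (i + 1)) := by
          intro i hi j hj hij
          have hi1 := Finset.mem_range.1 (Finset.mem_filter.1 (Finset.mem_filter.1 hi).1).1
          have hj1 := Finset.mem_range.1 (Finset.mem_filter.1 (Finset.mem_filter.1 hj).1).1
          simp only at hij
          rcases lt_trichotomy i j with h | h | h
          · exact absurd hij (roundBound_strictAnti (by omega) (by omega)).ne'
          · exact h
          · exact absurd hij (roundBound_strictAnti (by omega) (by omega)).ne
        rw [← Finset.sum_image (f := fun r => (1 / 2 : ℝ) ^ r) hinj]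
        refine sum_half_pow_le (by positivity) fun r hr => ?_
        obtain ⟨i, hi, rfl⟩ := Finset.mem_image.1 hr
        exact pow_le_pow_of_le_one (by norm_num) (by norm_num) (Finset.mem_filter.1 hi).2
      · rw [← Finset.mul_sum]
        exact mul_le_mul_of_nonneg_left (he T m G fun w hw => List.mem_toFinset.1 hw) zero_le_two
    have hlower := Finset.sum_le_sum hweight
    rw [Finset.sum_const, nsmul_eq_mul] at hlower
    have h1 := hlower.trans hupper
    have h2 : (misses.card : ℝ) * 2 ^ T ≤ 2 ^ (e + 1) * 2 ^ m := by
      have hp : (0 : ℝ) < 2 ^ (k + m) := by positivity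
      have h3 := mul_le_mul_of_nonneg_right h1 hp.le
      have h4 : (1 / 2 : ℝ) ^ (k + m) * 2 ^ (k + m) = 1 := by rw [← mul_pow]; norm_num
      have h5 : (1 / 2 : ℝ) ^ k * 2 ^ (k + m) = 2 ^ m := by
        rw [pow_add, ← mul_assoc, ← mul_pow]; norm_num
      calc (misses.card : ℝ) * 2 ^ T
          = misses.card * (2 ^ T * (1 / 2) ^ (k + m)) * 2 ^ (k + m) := by
            rw [mul_assoc, mul_assoc, h4, mul_one]
        _ ≤ 2 * (2 ^ e * (1 / 2) ^ k) * 2 ^ (k + m) := h3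
        _ = 2 * 2 ^ e * ((1 / 2) ^ k * 2 ^ (k + m)) := by ring
        _ = 2 ^ (e + 1) * 2 ^ m := by rw [h5, pow_succ]; ring
    have h3 : misses.card * 2 ^ T ≤ 2 ^ (e + 1) * 2 ^ m := by exact_mod_cast h2
    have h4 : 2 ^ (e + 1) * 4 ≤ 2 ^ T := by
      calc 2 ^ (e + 1) * 4 = 2 ^ (e + 3) := by ring
        _ ≤ 2 ^ T := Nat.pow_le_pow_right two_pos (by omega)
    have h5 : 2 ^ (e + 1) * (4 * misses.card) ≤ 2 ^ (e + 1) * 2 ^ m := by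
      calc 2 ^ (e + 1) * (4 * misses.card) = misses.card * (2 ^ (e + 1) * 4) := by ring
        _ ≤ misses.card * 2 ^ T := Nat.mul_le_mul_left _ h4
        _ ≤ _ := h3
    exact Nat.le_of_mul_le_mul_left h5 (by positivity)
  have := Nat.one_le_two_pow (n := m)
  omega

end Game

/-! ### Strings of maximal plain complexity -/

/-- The source of incompressibility: there are fewer than 2^n programs shorter than n. -/
theorem card_lt_two_pow {F : Finset (List Bool)} {n : ℕ} (h : ∀ u ∈ F, u.length < n) :
    F.card < 2 ^ n := by
  have hlen : ∀ n, ((List.range n).flatMap strs).length < 2 ^ n := by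
    intro n
    induction n with
    | zero => simp
    | succ n ih => simp only [List.range_succ, List.flatMap_append, List.length_append, pow_succ,
        List.flatMap_singleton, length_strs]; omega
  refine lt_of_le_of_lt ?_ (hlen n)
  refine (Finset.card_le_card (t := ((List.range n).flatMap strs).toFinset) fun u hu => ?_).trans
    (List.toFinset_card_le _)
  simpa using h u hu

theorem six_mul_sq_lt_two_pow {m : ℕ} (h : 10 ≤ m) : 6 * m ^ 2 < 2 ^ m := by
  induction m, h using Nat.le_induction with
  | base => norm_num
  | succ m h ih => rw [pow_succ 2]; nlinarith

/-- Whether by stage `s` a program of length at most `v` of `w` is found and all strings that begin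
with the `v`-th string of length `m + T + 3` and whose length has binary expansion `w` are found to
be compressible by more than `T + 5` bits. -/
def Revealed (SU SV : ℕ → List Bool → Option (List Bool))
    (x : (ℕ × ℕ) × ℕ × List Bool × ℕ) : Prop :=
  (∃ p ∈ strsLe x.2.1, p.length ≤ x.2.2.2 ∧ SV x.2.1 p = some x.2.2.1) ∧
  x.2.2.2 < 2 ^ (x.1.2 + x.1.1 + 3) ∧
  ∀ z ∈ strs (leVal x.2.2.1 - (x.1.2 + x.1.1 + 3)), ∃ u ∈ strsLe x.2.1,
    u.length + (x.1.1 + 5) < leVal x.2.2.1 ∧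
      SU x.2.1 u = some ((strs (x.1.2 + x.1.1 + 3)).getD x.2.2.2 [] ++ z)

theorem primrec_revealed {SU SV : ℕ → List Bool → Option (List Bool)} (hSU : Primrec₂ SU)
    (hSV : Primrec₂ SV) : PrimrecPred (Revealed SU SV) := by
  have hT : Primrec fun x : (ℕ × ℕ) × ℕ × List Bool × ℕ => x.1.1 := Primrec.fst.comp Primrec.fst
  have hm : Primrec fun x : (ℕ × ℕ) × ℕ × List Bool × ℕ => x.1.2 := Primrec.snd.comp Primrec.fst
  have hs : Primrec fun x : (ℕ × ℕ) × ℕ × List Bool × ℕ => x.2.1 := Primrec.fst.comp Primrec.snd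
  have hw : Primrec fun x : (ℕ × ℕ) × ℕ × List Bool × ℕ => x.2.2.1 :=
    Primrec.fst.comp (Primrec.snd.comp Primrec.snd)
  have hv : Primrec fun x : (ℕ × ℕ) × ℕ × List Bool × ℕ => x.2.2.2 :=
    Primrec.snd.comp (Primrec.snd.comp Primrec.snd)
  have hl : Primrec fun x : (ℕ × ℕ) × ℕ × List Bool × ℕ => x.1.2 + x.1.1 + 3 :=
    Primrec.nat_add.comp (Primrec.nat_add.comp hm hT) (Primrec.const 3)
  have hn : Primrec fun x : (ℕ × ℕ) × ℕ × List Bool × ℕ => leVal x.2.2.1 := primrec_leVal.comp hw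
  refine PrimrecPred.and ?_ (PrimrecPred.and ?_ ?_)
  · refine PrimrecPred.exists_mem (primrec_strsLe.comp hs) (PrimrecPred.and ?_ ?_)
    · exact Primrec.nat_le.comp (Primrec.list_length.comp Primrec.snd) (hv.comp Primrec.fst)
    · exact Primrec.eq.comp (hSV.comp (hs.comp Primrec.fst) Primrec.snd)
        (Primrec.option_some.comp (hw.comp Primrec.fst))
  · exact Primrec.nat_lt.comp hv (Primrec.nat_pow.comp (Primrec.const 2) hl)
  · refine PrimrecPred.forall_mem (primrec_strs.comp (Primrec.nat_sub.comp hn hl))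
      (PrimrecPred.exists_mem (primrec_strsLe.comp (hs.comp Primrec.fst)) (PrimrecPred.and ?_ ?_))
    · exact Primrec.nat_lt.comp (Primrec.nat_add.comp (Primrec.list_length.comp Primrec.snd)
        (Primrec.nat_add.comp (hT.comp (Primrec.fst.comp Primrec.fst)) (Primrec.const 5)))
        (hn.comp (Primrec.fst.comp Primrec.fst))
    · refine Primrec.eq.comp (hSU.comp (hs.comp (Primrec.fst.comp Primrec.fst)) Primrec.snd)
        (Primrec.option_some.comp (Primrec.list_append.comp ?_ (Primrec.snd.comp Primrec.fst)))
      exact (Primrec.list_getD []).comp (primrec_strs.comp (hl.comp (Primrec.fst.comp Primrec.fst)))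
        (hv.comp (Primrec.fst.comp Primrec.fst))

/-- The parameter `m` of the group of `w`, given the parameter `T`. -/
def groupLevel (T : ℕ) (w : List Bool) : ℕ :=
  Nat.findGreatest (fun m => (2 * T + 1) * 2 ^ m + 1 ≤ w.length) w.length

theorem primrec_groupLevel (T : ℕ) : Primrec (groupLevel T) := by
  refine Primrec.nat_findGreatest Primrec.list_length ?_
  exact Primrec.nat_le.comp (Primrec.succ.comp (Primrec.nat_mul.comp (Primrec.const (2 * T + 1))
    (Primrec.nat_pow.comp (Primrec.const 2) Primrec.snd))) (Primrec.list_length.comp Primrec.fst)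

/-- With T fixed, m is computable from `w`, so a decoder learns the length of the block for free. -/
theorem groupLevel_eq {T m : ℕ} {w : List Bool} (hw : w ∈ group T m) : groupLevel T w = m := by
  obtain ⟨y, hy, rfl⟩ := mem_group.1 hw
  have hl : (y ++ [true]).length = (2 * T + 1) * 2 ^ m + 1 := by simp [hy]
  have hlt : m < 2 ^ m := Nat.lt_two_pow_self
  refine Nat.findGreatest_eq_iff.2 ⟨?_, fun _ => hl.ge, fun n hn _ => ?_⟩
  · rw [hl]
    nlinarith
  · rw [hl, not_le]
    have := Nat.pow_lt_pow_right one_lt_two hn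
    have := Nat.mul_lt_mul_of_pos_left this (by omega : 0 < 2 * T + 1)
    omega

/-- Some member of each late group of a suitable sequence does not reveal its complexity. -/
theorem exists_incompressible {U V : Machine} (hU : IsOptimalPlain U)
    (hV : IsOptimalPrefixFree V) :
    ∃ T M, ∀ m ≥ M, ∃ w ∈ group T m, strComplexity V w < 2 ^ (m + T + 3) ∧
      m + T + 3 ≤ leVal w ∧
      ∃ z : List Bool, z.length = leVal w - (m + T + 3) ∧
        leVal w ≤ strComplexity U ((strs (m + T + 3)).getD (strComplexity V w) [] ++ z) + (T + 5) := by
  classical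
  have hU0 : Partrec fun p => U p [] := hU.1.comp Computable.id (Computable.const [])
  have hV0 : Partrec fun p => V p [] := hV.1.1.comp Computable.id (Computable.const [])
  obtain ⟨SU, hSU, hSUmono, hSUspec⟩ := hU0.exists_stages
  obtain ⟨SV, hSV, hSVmono, hSVspec⟩ := hV0.exists_stages
  have hR := primrec_revealed hSU hSV
  have hmono : ∀ t s s' w v, s ≤ s' → Revealed SU SV (t, s, w, v) →
      Revealed SU SV (t, s', w, v) := by
    rintro t s s' w v hs ⟨⟨p, hp, hpv, hpw⟩, h2, h3⟩
    refine ⟨⟨p, ?_, hpv, hSVmono _ _ _ _ hs hpw⟩, h2, fun z hz => ?_⟩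
    · rw [mem_strsLe] at hp ⊢
      exact hp.trans hs
    · obtain ⟨u, hu, hul, huz⟩ := h3 z hz
      refine ⟨u, ?_, hul, hSUmono _ _ _ _ hs huz⟩
      rw [mem_strsLe] at hu ⊢
      exact hu.trans hs
  -- T is an argument of `Revealed`, so T₀ does not depend on the T chosen below.
  obtain ⟨T₀, hT₀⟩ := hV.exists_mem_group hR hmono (by
    rintro t s w v ⟨⟨p, -, hpv, hpw⟩, -⟩
    exact (strComplexity_le ((hSVspec p w).2 ⟨s, hpw⟩)).trans hpv)
  obtain ⟨d, hd⟩ := hV.exists_candidate_bound hR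
  obtain ⟨d', hd'⟩ := hV.exists_strComplexity_replicate_le
  let T := T₀ + 1
  refine ⟨T, T + 1 + d + d' + 10, fun m hm => ?_⟩
  have hsix := six_mul_sq_lt_two_pow (m := m) (by omega)
  have hmpow : m < 2 ^ m := Nat.lt_two_pow_self
  have hTpow : T < 2 ^ T := Nat.lt_two_pow_self
  have hn : ∀ w ∈ group T m, m + T + 3 ≤ leVal w := by
    intro w hw
    obtain ⟨y, hy, rfl⟩ := mem_group.1 hw
    have h1 := (leVal_append_true_bounds y).1
    have h2 : y.length < 2 ^ y.length := Nat.lt_two_pow_self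
    have h3 : m + T + 2 ≤ y.length := by
      rw [hy]
      have : 1 ≤ T := by omega
      nlinarith
    omega
  obtain ⟨w, hw, hwR⟩ := hT₀ T (by omega) m (by
    intro w hw F hF
    have hnw := hn w hw
    obtain ⟨a, ha⟩ := Nat.exists_eq_add_of_le hnw
    choose! s hs using hF
    -- Each revealed value claims 2^a strings with programs shorter than a + (m - 2), since (m + T +
    -- 3) - (T + 5) = m - 2. This leaves room for fewer than 2^(m-2) values.
    have hprog : ∀ x ∈ F ×ˢ (strs a).toFinset, ∃ u : List Bool, u.length < a + (m - 2) ∧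
        (strs (m + T + 3)).getD x.1 [] ++ x.2 ∈ U u [] := by
      rintro ⟨v, z⟩ hx
      rw [Finset.mem_product, List.mem_toFinset] at hx
      obtain ⟨-, -, h3⟩ := hs v hx.1
      obtain ⟨u, -, hul, huz⟩ := h3 z (by
        simp only [ha, Nat.add_sub_cancel_left]; exact hx.2)
      refine ⟨u, ?_, (hSUspec _ _).2 ⟨_, huz⟩⟩
      simp only [ha] at hul
      omega
    choose! u hul hux using hprog
    have hvlt : ∀ v ∈ F, v < 2 ^ (m + T + 3) := fun v hv => (hs v hv).2.1
    have hinj : Set.InjOn u (F ×ˢ (strs a).toFinset : Finset (ℕ × List Bool)) := by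
      rintro ⟨v, z⟩ hx ⟨v', z'⟩ hx' h
      have e := Part.mem_unique (hux _ hx) (h ▸ hux _ hx')
      simp only [Finset.coe_product, Set.mem_prod, Finset.mem_coe] at hx hx'
      have hv := hvlt v hx.1
      have hv' := hvlt v' hx'.1
      rw [← length_strs (m + T + 3)] at hv hv'
      simp only [List.getD_eq_getElem _ _ hv, List.getD_eq_getElem _ _ hv'] at e
      obtain ⟨e1, e2⟩ := List.append_inj e (by
        rw [mem_strs.1 (List.getElem_mem hv), mem_strs.1 (List.getElem_mem hv')])
      rw [(nodup_strs _).getElem_inj_iff] at e1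
      rw [e1, e2]
    have hc := card_lt_two_pow (F := (F ×ˢ (strs a).toFinset).image u) (n := a + (m - 2)) (by
      intro x hx
      obtain ⟨y, hy, rfl⟩ := Finset.mem_image.1 hx
      exact hul y hy)
    rw [Finset.card_image_of_injOn hinj, Finset.card_product,
      List.toFinset_card_of_nodup (nodup_strs a), length_strs, pow_add, mul_comm] at hc
    have h1 := Nat.lt_of_mul_lt_mul_left hc
    have h2 : 2 ^ m = 2 ^ (m - 2) * 4 := by
      rw [show (4 : ℕ) = 2 ^ 2 by norm_num, ← pow_add]
      congr 1
      omega
    omega)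
  -- The bound on candidates at round 0 covers the whole group; the terms in m^2 and the constants
  -- are absorbed by 2^m.
  have hKw : strComplexity V w < 2 ^ (m + T + 3) := by
    have h1 := hd T m 0 (by positivity) (group T m) (Part.mem_some _)
      (by simp [group, roundSize]) w hw
    have h2 : strComplexity V (groupName T m) ≤ (m + T + 1) ^ 2 + d' := by
      refine (hd' _).trans (Nat.add_le_add_right ?_ _)
      refine (Nat.pair_lt_max_add_one_sq T m).le.trans (Nat.pow_le_pow_left ?_ 2)
      omega
    have h3 : roundSize T m 0 = (2 * T + 1) * 2 ^ m := by rw [roundSize, Nat.sub_zero]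
    have h4 : 2 ^ (m + T + 3) = 8 * (2 ^ T * 2 ^ m) := by rw [pow_add, pow_add]; ring
    have h5 : (T + 1) * 2 ^ m ≤ 2 ^ T * 2 ^ m := Nat.mul_le_mul_right _ hTpow
    have h6 : (m + T + 1) ^ 2 + m + (d + d') ≤ 6 * m ^ 2 := by
      have : m + T + 1 ≤ 2 * m := by omega
      have := Nat.pow_le_pow_left this 2
      nlinarith
    rw [h4]
    nlinarith
  refine ⟨w, hw, hKw, hn w hw, ?_⟩
  -- If every z failed, a single stage N would contain all the witnesses, and K(w) would be
  -- revealed.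
  by_contra hcon
  push Not at hcon
  obtain ⟨p, hp, hpw⟩ := exists_program (hV.complexity_ne_top w)
  obtain ⟨s₀, hs₀⟩ := (hSVspec p w).1 hpw
  have hz : ∀ z : List Bool, z.length = leVal w - (m + T + 3) → ∃ u s, u.length + (T + 5) < leVal w ∧
      SU s u = some ((strs (m + T + 3)).getD (strComplexity V w) [] ++ z) := by
    intro z hz
    obtain ⟨u, hu, hux⟩ := exists_program
      (hU.complexity_ne_top ((strs (m + T + 3)).getD (strComplexity V w) [] ++ z))
    obtain ⟨s, hs⟩ := (hSUspec _ _).1 hux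
    exact ⟨u, s, hu ▸ hcon z hz, hs⟩
  choose! u s hul hus using hz
  let N := max (max s₀ p.length)
    ((strs (leVal w - (m + T + 3))).toFinset.sup fun z => max (s z) (u z).length)
  refine hwR N ⟨⟨p, ?_, hp.le, hSVmono _ _ _ _ ?_ hs₀⟩, hKw, fun z hz => ⟨u z, ?_, ?_, ?_⟩⟩
  · exact mem_strsLe.2 ((le_max_right _ _).trans (le_max_left _ _))
  · exact (le_max_left _ _).trans (le_max_left _ _)
  all_goals
    have hN : max (s z) (u z).length ≤ N :=
      (Finset.le_sup (f := fun z => max (s z) (u z).length) (List.mem_toFinset.2 hz)).trans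
        (le_max_right _ _)
    have hz' := mem_strs.1 hz
  · exact mem_strsLe.2 ((le_max_right _ _).trans hN)
  · exact hul z hz'
  · exact hSUmono _ _ _ _ ((le_max_left _ _).trans hN) (hus z hz')

/-! ### The double logarithm and the conclusion -/

theorem logb_logb_leVal_le {T m : ℕ} {w : List Bool} (hw : w ∈ group T m) :
    Real.logb 2 (Real.logb 2 (leVal w)) ≤ (m + T + 3 : ℕ) := by
  obtain ⟨y, hy, rfl⟩ := mem_group.1 hw
  obtain ⟨h1, h2⟩ := leVal_append_true_bounds y
  set n := leVal (y ++ [true])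
  have hpos : 0 < y.length := by rw [hy]; positivity
  have hn2 : 2 ≤ n := (Nat.pow_le_pow_right two_pos hpos : 2 ^ 1 ≤ 2 ^ y.length).trans h1
  have hn2' : (2 : ℝ) ≤ n := by exact_mod_cast hn2
  have hlog : Real.logb 2 n ≤ (y.length + 1 : ℕ) := by
    rw [Real.logb_le_iff_le_rpow one_lt_two (by linarith), Real.rpow_natCast]
    exact_mod_cast h2.le
  have hlpos : 0 < Real.logb 2 n := Real.logb_pos one_lt_two (by linarith)
  rw [Real.logb_le_iff_le_rpow one_lt_two hlpos, Real.rpow_natCast]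
  refine hlog.trans ?_
  -- The length (2T+1)2^m + 1 of `w` is at most 2 to the length of the block.
  have : y.length + 1 ≤ 2 ^ (m + T + 3) := by
    rw [hy]
    have hTpow : T < 2 ^ T := Nat.lt_two_pow_self
    have hm := Nat.one_le_two_pow (n := m)
    have h5 : (T + 1) * 2 ^ m ≤ 2 ^ T * 2 ^ m := Nat.mul_le_mul_right _ hTpow
    have h4 : 2 ^ (m + T + 3) = 8 * (2 ^ T * 2 ^ m) := by rw [pow_add, pow_add]; ring
    rw [h4]
    nlinarith
  exact_mod_cast this

theorem mainTheorem4 (U V : Machine) (hU : IsOptimalPlain U) (hV : IsOptimalPrefixFree V) :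
    ∃ c : ℝ, {x : List Bool |
      (x.length : ℝ) - (strComplexity U x : ℝ) ≤ c ∧
      (x.length : ℝ) + (natComplexity V x.length : ℝ) - (strComplexity V x : ℝ) ≥
        Real.logb 2 (Real.logb 2 (x.length : ℝ)) - c}.Infinite := by
  obtain ⟨T, M, hTM⟩ := exists_incompressible hU hV
  have hlevel : Primrec fun w => groupLevel T w + T + 3 :=
    Primrec.nat_add.comp (Primrec.nat_add.comp (primrec_groupLevel T) (Primrec.const T))
      (Primrec.const 3)
  obtain ⟨d, hd⟩ := hV.exists_strComplexity_comp_le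
    (len := fun w => leVal w - (groupLevel T w + T + 3)) (Primrec.nat_sub.comp primrec_leVal hlevel)
    (F := fun x => Part.some ((strs (groupLevel T x.1 + T + 3)).getD x.2.1 [] ++ x.2.2)) (by
      refine (Primrec.list_append.comp ((Primrec.list_getD []).comp (primrec_strs.comp
        (hlevel.comp Primrec.fst)) (Primrec.fst.comp Primrec.snd))
        (Primrec.snd.comp Primrec.snd)).to_comp.partrec)
  -- T + 5 bounds the deficiency in plain complexity, d is the cost of decoding x; infinity follows
  -- from unbounded lengths.
  refine ⟨(T + 5 + d : ℕ), Set.Infinite.of_image List.length ?_⟩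
  refine Set.infinite_of_forall_exists_gt fun N => ?_
  obtain ⟨w, hw, hKw, hn, z, hz, hCx⟩ := hTM (max M N) (le_max_left _ _)
  set m := max M N
  have hlen : ((strs (m + T + 3)).getD (strComplexity V w) []).length = m + T + 3 := by
    have hK' := hKw
    rw [← length_strs (m + T + 3)] at hK'
    rw [List.getD_eq_getElem _ _ hK', mem_strs.1 (List.getElem_mem hK')]
  set x := (strs (m + T + 3)).getD (strComplexity V w) [] ++ z with hx
  have hxlen : x.length = leVal w := by
    rw [hx, List.length_append, hlen, hz]
    omega
  refine ⟨leVal w, ⟨x, ⟨?_, ?_⟩, hxlen⟩, ?_⟩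
  · rw [hxlen]
    have : (leVal w : ℝ) ≤ strComplexity U x + (T + 5) := by exact_mod_cast hCx
    push_cast
    linarith [(Nat.cast_nonneg d : (0 : ℝ) ≤ d)]
  · have hnat : natComplexity V x.length = strComplexity V w := by
      -- `w` is the binary expansion of |x|, so the K(w) stored in the block is the K(|x|) of the
      -- theorem.
      obtain ⟨y, -, rfl⟩ := mem_group.1 hw
      rw [natComplexity, hxlen, bits_leVal]
    have hKx := hd w z x (by rw [groupLevel_eq hw, hz]) (by
      rw [groupLevel_eq hw]; exact Part.mem_some _)
    rw [hnat, hxlen]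
    have hsum : strComplexity V x + (m + T + 3) ≤ strComplexity V w + leVal w + d := by omega
    have hsum' : (strComplexity V x : ℝ) + (m + T + 3 : ℕ) ≤ strComplexity V w + leVal w + d := by
      exact_mod_cast hsum
    have := logb_logb_leVal_le hw
    push_cast at *
    linarith [(Nat.cast_nonneg T : (0 : ℝ) ≤ T)]
  · have : N ≤ m := le_max_right _ _
    omega
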